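/- **Setting (comparative independent cascade).** A network is a finite vertex set $V$ with probabilities $p(x,y)\in[0,1]$ on directed edges. Two ideas $A,B$ spread in discrete time; the parameters $q_{A|\emptyset},q_{A|B},q_{B|\emptyset},q_{B|A}\in[0,1]$ are complementary, i.e. $q_{A|\emptyset}\le q_{A|B}$ and $q_{B|\emptyset}\le q_{B|A}$. Each edge $(x,y)$ is independently live with probability $p(x,y)$. At time $0$ exactly the vertices of $S_A$ adopt $A$ and those of $S_B$ adopt $B$, whatever the parameters are (a fair coin decides the order at common seeds). A vertex that adopted an idea at time $t-1$ proposes it at time $t$ along its live out-edges; simultaneous proposals to a vertex are tried in a uniformly random fixed order of its in-neighbours, and an in-neighbour that adopted both ideas in the same step proposes them in the order of adoption. A vertex reacts only to the first $A$-proposal it receives, and only if it has not adopted $A$: it adopts $A$ with probability $q_{A|B}$ if it has already adopted $B$ and with probability $q_{A|\emptyset}$ otherwise; symmetrically for $B$. Without reconsideration a refusal is final. With reconsideration, a vertex that refused $A$ while it had not adopted $B$, and that adopts $B$ later, at that moment reconsiders $A$ once and adopts it with probability $\rho_A$, where $\rho_A\in[0,1]$ satisfies $$q_{A|\emptyset}+(1-q_{A|\emptyset})\,q_{B|\emptyset}\,\rho_A=(1-q_{B|\emptyset})\,q_{A|\emptyset}+q_{B|\emptyset}\,q_{A|B},$$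 and symmetrically for $B$ with $\rho_B$. Let $\sigma_A(S_A,S_B)$ be the expected number of vertices that eventually adopt $A$. A function $f:2^V\to\mathbb R$ is submodular if $f(S)+f(S\cup\{x,y\})\le f(S\cup\{x\})+f(S\cup\{y\})$ for all $S\subseteq V$ and $x,y\in V$. **Theorem.** Let the two ideas be complementary, with or without reconsideration. 1. If $q_{A|\emptyset}=q_{A|B}$ or $q_{B|\emptyset}=1$, then on every network and for every fixed $S_A$ the function $S_B\mapsto\sigma_A(S_A,S_B)$ is submodular. 2. On the directed path $a\to v\to b\to u$ with four vertices and all edge probabilities $1$, with $S_A=\{a\}$ and $S_B=\{b\}$, one has, for all parameters with $q_{A|\emptyset}\ne q_{A|B}$ and $q_{B|\emptyset}\ne1$, $$\sigma_A(S_A,S_B)+\sigma_A(S_A,S_B\cup\{u,v\})>\sigma_A(S_A,S_B\cup\{u\})+\sigma_A(S_A,S_B\cup\{v\}).$$ 3. In particular $q_{B|A}=1$ is not sufficient for submodularity of $\sigma_A$ in $S_B$: there are complementary parameters with $q_{B|A}=1$ for which $S_B\mapsto\sigma_A(\{a\},S_B)$ on this path is not submodular (this refutes Theorem 5 of Lu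 et al.). -/

import Mathlib

noncomputable section

namespace ComIC

/-- The two ideas spreading in the network. -/
inductive Idea
  | A
  | B
  deriving DecidableEq

instance : Fintype Idea := ⟨{.A, .B}, fun i => by cases i <;> simp⟩

/-- The idea different from the given one. -/
def Idea.other : Idea → Idea
  | .A => .B
  | .B => .A

/-- The status of a vertex with respect to one idea. The status `suspended` is only ever
entered when reconsideration is allowed. -/
inductive Status
  | idle
  | suspended
  | adopted
  | rejected
  deriving DecidableEq

/-- The random decisions a vertex may have to take about an idea `i`:
* `alone`: an `i`-proposal arrives while the other idea is not adopted;
* `given`: an `i`-proposal arrives while the other idea is adopted;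
* `reconsider`: the vertex reconsiders `i` after adopting the other idea. -/
inductive Decision
  | alone
  | given
  | reconsider
  deriving DecidableEq

instance : Fintype Decision := ⟨{.alone, .given, .reconsider}, fun d => by cases d <;> simp⟩

/-- Global adoption probabilities: `alone A` is `q_{A|∅}`, `given A` is `q_{A|B}`,
`alone B` is `q_{B|∅}` and `given B` is `q_{B|A}`. -/
structure GAP where
  alone : Idea → ℝ
  given : Idea → ℝ

/-- The two ideas are mutually complementary: the parameters are probabilities with
`q_{A|∅} ≤ q_{A|B}` and `q_{B|∅} ≤ q_{B|A}`. -/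
def GAP.Complementary (q : GAP) : Prop :=
  ∀ i, 0 ≤ q.alone i ∧ q.alone i ≤ q.given i ∧ q.given i ≤ 1

/-- `ρ` is an admissible pair of reconsideration probabilities for `q`: the probability that a
vertex adopts `i` does not depend on which of the two ideas makes its proposal first. -/
def GAP.Admissible (q : GAP) (ρ : Idea → ℝ) : Prop :=
  ∀ i, 0 ≤ ρ i ∧ ρ i ≤ 1 ∧
    q.alone i + (1 - q.alone i) * q.alone i.other * ρ i =
      (1 - q.alone i.other) * q.alone i + q.alone i.other * q.given i

/-- A network on the vertex set `V`: `p u v` is the probability of the directed edge from `u`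
to `v`, and pairs that are not edges have probability `0`. -/
structure Network (V : Type*) where
  p : V → V → ℝ
  p_nonneg : ∀ u v, 0 ≤ p u v
  p_le_one : ∀ u v, p u v ≤ 1

/-- The data of one vertex during the cascade: its status for each idea, and the list of the
ideas it adopted in the current time step, in the order of adoption. -/
structure Node where
  status : Idea → Status
  fresh : List Idea

/-- Give idea `i` the (non-adopting) status `s`. -/
def Node.mark (x : Node) (i : Idea) (s : Status) : Node :=
  { x with status := Function.update x.status i s }

/-- Adopt idea `i`. -/
def Node.adopt (x : Node) (i : Idea) : Node :=
  { status := Function.update x.status i .adopted, fresh := x.fresh ++ [i] }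

/-- Reaction of a vertex to an `i`-proposal, where `coin j d` is the outcome of decision `d` on
idea `j` (`true` means adoption) and `recon` tells whether reconsideration is allowed. -/
def Node.receive (recon : Bool) (coin : Idea → Decision → Bool) (x : Node) (i : Idea) : Node :=
  if x.status i = .idle then
    if x.status i.other = .adopted then
      if coin i .given then x.adopt i else x.mark i .rejected
    else if coin i .alone then
      if x.status i.other = .suspended then
        if coin i.other .reconsider then (x.adopt i).adopt i.other
        else (x.adopt i).mark i.other .rejected
      else x.adopt i
    else if recon then x.mark i .suspended
    else x.mark i .rejected
  else x

/-- A possible world: all the randomness of the cascade. Every vertex takes each of its random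
decisions at most once, so one coin per vertex, idea and decision suffices. -/
structure World (V : Type*) [Fintype V] where
  /-- whether the edge from `u` to `v` lets proposals through -/
  live : V → V → Bool
  /-- the order in which the in-neighbours of a vertex make simultaneous proposals to it -/
  order : V → (Fin (Fintype.card V) ≃ V)
  /-- the idea which a vertex that is a seed of both ideas adopts first -/
  first : V → Idea
  /-- the outcomes of the decisions of the vertices -/
  coin : V → Idea → Decision → Bool

/-- A world is the tuple of its components. -/
def World.equivProd (V : Type*) [Fintype V] :
    World V ≃ (V → V → Bool) × (V → (Fin (Fintype.card V) ≃ V)) × (V → Idea) ×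
      (V → Idea → Decision → Bool) where
  toFun W := (W.live, W.order, W.first, W.coin)
  invFun x := ⟨x.1, x.2.1, x.2.2.1, x.2.2.2⟩
  left_inv _ := rfl
  right_inv _ := rfl

instance (V : Type*) [Fintype V] [DecidableEq V] : Fintype (World V) :=
  Fintype.ofEquiv _ (World.equivProd V).symm

section Cascade

variable {V : Type*} [Fintype V] [DecidableEq V]

/-- Time `0`: exactly the seeds adopt, whatever the adoption probabilities are. -/
def World.init (W : World V) (S : Idea → Finset V) (v : V) : Node where
  status i := if v ∈ S i then .adopted else .idle
  fresh := [W.first v, (W.first v).other].filter fun i => v ∈ S i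

/-- The proposals that reach `v` in one time step, in the order in which they are tried. -/
def World.inbox (W : World V) (x : V → Node) (v : V) : List Idea :=
  (List.ofFn (W.order v)).flatMap fun u => if W.live u v then (x u).fresh else []

/-- One time step of the cascade. -/
def World.step (W : World V) (recon : Bool) (x : V → Node) (v : V) : Node :=
  (W.inbox x v).foldl (Node.receive recon (W.coin v)) { status := (x v).status, fresh := [] }

/-- The configuration at time `t` for the seed sets `S`. -/
def World.cascade (W : World V) (recon : Bool) (S : Idea → Finset V) : ℕ → V → Node
  | 0 => W.init S
  | t + 1 => W.step recon (W.cascade recon S t)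

/-- Vertex `v` adopts idea `i` in the course of the cascade (adoption is permanent). -/
def World.Adopts (W : World V) (recon : Bool) (S : Idea → Finset V) (i : Idea) (v : V) : Prop :=
  ∃ t, (W.cascade recon S t v).status i = .adopted

/-- The pair of seed sets as a family. -/
def seeds (SA SB : Finset V) : Idea → Finset V
  | .A => SA
  | .B => SB

open Classical in
/-- `σ_A(S_A, S_B, W)`: the number of vertices that adopt `A` in the world `W`. -/
def World.influenceA (W : World V) (recon : Bool) (SA SB : Finset V) : ℕ :=
  (Finset.univ.filter fun v => W.Adopts recon (seeds SA SB) .A v).card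

/-- Probability that a coin with success probability `r` shows `b`. -/
def coinProb (r : ℝ) (b : Bool) : ℝ := if b then r else 1 - r

/-- The probability of adoption in each kind of decision. -/
def GAP.prob (q : GAP) (ρ : Idea → ℝ) (i : Idea) : Decision → ℝ
  | .alone => q.alone i
  | .given => q.given i
  | .reconsider => ρ i

/-- The probability of a world: all components are independent, the orders of the in-neighbours
are uniform, and the order of adoption at common seeds is decided by a fair coin. -/
def World.weight (W : World V) (N : Network V) (q : GAP) (ρ : Idea → ℝ) : ℝ :=
  (∏ u, ∏ v, coinProb (N.p u v) (W.live u v)) *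
    ∏ v, ((1 / (Nat.factorial (Fintype.card V) : ℝ)) * (1 / 2) *
      ∏ i, ∏ d, coinProb (q.prob ρ i d) (W.coin v i d))

/-- `σ_A(S_A, S_B)`: the expected number of vertices that adopt `A`. -/
def sigmaA (recon : Bool) (N : Network V) (q : GAP) (ρ : Idea → ℝ) (SA SB : Finset V) : ℝ :=
  ∑ W : World V, W.weight N q ρ * (W.influenceA recon SA SB : ℝ)

/-- Submodularity of a set function. -/
def Submodular (f : Finset V → ℝ) : Prop :=
  ∀ (S : Finset V) (a b : V), f S + f (S ∪ {a, b}) ≤ f (S ∪ {a}) + f (S ∪ {b})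

end Cascade

/-- The directed path `0 → 1 → 2 → 3`, all edges having probability `1`. -/
def pathNetwork : Network (Fin 4) where
  p u v := if u.val + 1 = v.val then 1 else 0
  p_nonneg u v := by split_ifs <;> norm_num
  p_le_one u v := by split_ifs <;> norm_num

end ComIC

end

/-! Sufficiency rests on a coupling. At its first `A`-proposal a vertex either has adopted `B` and
consults `given A`, which settles `A` for good, or has not and consults `alone A`, possibly followed
by `reconsider A`. No cascade consults both kinds of coin at one vertex, so their joint law does not
affect `σ_A`: `given A` may be replaced by any function `κ` of the other two coins with success
probability `q_{A|B}` (`sigmaA_eq_couple`).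

If `q_{A|∅} = q_{A|B}`, take `κ = alone`. Admissibility makes successful reconsideration of `A`
impossible in worlds of nonzero weight, so `A` spreads independently of the `B`-seeds and `σ_A` is
constant in `S_B`.

If `q_{B|∅} = 1`, every `B`-proposal is accepted, and admissibility permits `κ = alone ∨
reconsider`. In each coupled world the `A`-adopters for a union of `B`-seed sets are then the union
of the `A`-adopters for the separate sets (`adopts_iff_exists`), so their number is a coverage
function of `S_B`. To see this, record proposals and adoptions as words in `A` and `B`. Extra
`B`-seeds can only destroy the event "starts with `A`", while "contains `B`" and "`A` occurs, but
not first" are each caused by a single member of the union. Such a covering (`Covers`) survives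
concatenation and the reaction of a vertex.

For necessity, the four sums on the path are compared world by world. The seed at vertex 1 matters
by switching that vertex from `alone A` to `given A`; the seed at vertex 3 matters only if vertex 3
refuses `B` from vertex 2. The discrepancy is a product of functions of the coins of vertices 1, 2
and 3; by independence its expectation is a product of positive numbers. -/

noncomputable section

namespace ComIC

/-! ### Expectations over worlds and independence of coins -/

section Probability

variable {V : Type*} [Fintype V] [DecidableEq V]

/-- Replace all coins of the vertex `v`. -/
def World.setCoin (W : World V) (v : V) (c : Idea → Decision → Bool) : World V :=
  { W with coin := Function.update W.coin v c }

@[simp] lemma World.setCoin_live (W : World V) (v : V) (c : Idea → Decision → Bool) :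
    (W.setCoin v c).live = W.live := rfl

@[simp] lemma World.setCoin_coin (W : World V) (v : V) (c : Idea → Decision → Bool) :
    (W.setCoin v c).coin = Function.update W.coin v c := rfl

lemma World.setCoin_setCoin (W : World V) (v : V) (c c' : Idea → Decision → Bool) :
    (W.setCoin v c).setCoin v c' = W.setCoin v c' := by
  simp [World.setCoin]

lemma World.setCoin_self (W : World V) (v : V) : W.setCoin v (W.coin v) = W := by
  simp [World.setCoin]

/-- Exchange the coins of `v` with given ones. -/
def swapCoin (v : V) :
    World V × (Idea → Decision → Bool) ≃ World V × (Idea → Decision → Bool) where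
  toFun x := (x.1.setCoin v x.2, x.1.coin v)
  invFun x := (x.1.setCoin v x.2, x.1.coin v)
  left_inv x := by simp [World.setCoin_setCoin, World.setCoin_self]
  right_inv x := by simp [World.setCoin_setCoin, World.setCoin_self]

/-- Swapping the coins of `v` with a fresh set is an involution on pairs, so resampling produces
each world equally often. -/
lemma sum_setCoin (F : World V → ℝ) (v : V) :
    ∑ W : World V, ∑ c, F (W.setCoin v c) =
      Fintype.card (Idea → Decision → Bool) * ∑ W, F W := by
  have h := Equiv.sum_comp (swapCoin v) (fun x => F x.1)
  rw [Fintype.sum_prod_type, Fintype.sum_prod_type] at h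
  simp only [swapCoin, Equiv.coe_fn_mk] at h
  rw [h, Finset.mul_sum]
  simp

/-- The probability of the outcomes of all coins of one vertex. -/
def GAP.coinsProb (q : GAP) (ρ : Idea → ℝ) (c : Idea → Decision → Bool) : ℝ :=
  ∏ i, ∏ d, coinProb (q.prob ρ i d) (c i d)

lemma weight_setCoin (W : World V) (N : Network V) (q : GAP) (ρ : Idea → ℝ) (v : V) :
    ∃ r : ℝ, ∀ c, (W.setCoin v c).weight N q ρ = r * q.coinsProb ρ c := by
  refine ⟨(∏ u, ∏ v, coinProb (N.p u v) (W.live u v)) *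
    ((1 / (Nat.factorial (Fintype.card V) : ℝ)) * (1 / 2) *
      ∏ u ∈ Finset.univ.erase v, ((1 / (Nat.factorial (Fintype.card V) : ℝ)) * (1 / 2) *
        ∏ i, ∏ d, coinProb (q.prob ρ i d) (W.coin u i d))), fun c => ?_⟩
  unfold World.weight
  rw [← Finset.mul_prod_erase Finset.univ
    (fun u => (1 / (Nat.factorial (Fintype.card V) : ℝ)) * (1 / 2) *
      ∏ i, ∏ d, coinProb (q.prob ρ i d) ((W.setCoin v c).coin u i d)) (Finset.mem_univ v)]
  have : ∏ u ∈ Finset.univ.erase v, ((1 / (Nat.factorial (Fintype.card V) : ℝ)) * (1 / 2) *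
        ∏ i, ∏ d, coinProb (q.prob ρ i d) ((W.setCoin v c).coin u i d)) =
      ∏ u ∈ Finset.univ.erase v, ((1 / (Nat.factorial (Fintype.card V) : ℝ)) * (1 / 2) *
        ∏ i, ∏ d, coinProb (q.prob ρ i d) (W.coin u i d)) := by
    refine Finset.prod_congr rfl fun u hu => ?_
    simp [Function.update_of_ne (Finset.ne_of_mem_erase hu)]
  rw [this]
  simp only [World.setCoin_live, World.setCoin_coin, Function.update_self, GAP.coinsProb]
  ring

/-- Two random variables with the same conditional expectation given everything but the coins
of one vertex have the same expectation. -/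
lemma sum_weight_congr_of_setCoin (N : Network V) (q : GAP) (ρ : Idea → ℝ) (v : V)
    {F G : World V → ℝ}
    (h : ∀ W : World V, ∑ c, q.coinsProb ρ c * F (W.setCoin v c) =
      ∑ c, q.coinsProb ρ c * G (W.setCoin v c)) :
    ∑ W : World V, W.weight N q ρ * F W = ∑ W : World V, W.weight N q ρ * G W := by
  have key : ∑ W : World V, ∑ c, (W.setCoin v c).weight N q ρ * F (W.setCoin v c) =
      ∑ W : World V, ∑ c, (W.setCoin v c).weight N q ρ * G (W.setCoin v c) := by
    refine Finset.sum_congr rfl fun W _ => ?_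
    obtain ⟨r, hr⟩ := weight_setCoin W N q ρ v
    simp only [hr, mul_assoc, ← Finset.mul_sum, h]
  rw [sum_setCoin (fun W => W.weight N q ρ * F W), sum_setCoin (fun W => W.weight N q ρ * G W)]
    at key
  exact mul_left_cancel₀ (by simp) key

@[simp] lemma sum_coinProb (r : ℝ) : ∑ b, coinProb r b = 1 := by simp [coinProb]

lemma sum_prod_coinProb {ι : Type*} [Fintype ι] [DecidableEq ι] (r : ι → ℝ) :
    ∑ c : ι → Bool, ∏ i, coinProb (r i) (c i) = 1 := by
  have := Finset.prod_univ_sum (fun _ : ι => (Finset.univ : Finset Bool))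
    (fun i b => coinProb (r i) b)
  rw [Fintype.piFinset_univ] at this
  simp only [← this, sum_coinProb, Finset.prod_const_one]

lemma sum_coinsProb (q : GAP) (ρ : Idea → ℝ) : ∑ c, q.coinsProb ρ c = 1 := by
  have := Finset.prod_univ_sum (fun _ : Idea => (Finset.univ : Finset (Decision → Bool)))
    (fun i c => ∏ d, coinProb (q.prob ρ i d) (c d))
  rw [Fintype.piFinset_univ] at this
  unfold GAP.coinsProb
  simp [← this, sum_prod_coinProb]

lemma sum_weight (N : Network V) (q : GAP) (ρ : Idea → ℝ) :
    ∑ W : World V, W.weight N q ρ = 1 := by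
  rw [← Equiv.sum_comp (World.equivProd V).symm]
  simp only [Fintype.sum_prod_type, World.weight, World.equivProd, Equiv.coe_fn_symm_mk,
    Finset.prod_mul_distrib]
  have hlive : ∑ l : V → V → Bool, ∏ u, ∏ v, coinProb (N.p u v) (l u v) = 1 := by
    have := Finset.prod_univ_sum (fun _ : V => (Finset.univ : Finset (V → Bool)))
      (fun u c => ∏ v, coinProb (N.p u v) (c v))
    rw [Fintype.piFinset_univ] at this
    simp [← this, sum_prod_coinProb]
  have hcoin : ∑ l : V → Idea → Decision → Bool, ∏ v, ∏ i, ∏ d,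
      coinProb (q.prob ρ i d) (l v i d) = 1 := by
    have := Finset.prod_univ_sum
      (fun _ : V => (Finset.univ : Finset (Idea → Decision → Bool)))
      (fun _ c => q.coinsProb ρ c)
    rw [Fintype.piFinset_univ] at this
    simp only [sum_coinsProb, Finset.prod_const_one] at this
    exact this.symm
  simp only [← Finset.mul_sum, hcoin, mul_one, Finset.sum_const, ← Finset.sum_mul, hlive]
  -- The weight does not depend on the orders and first ideas, so their number `(n!)^n * 2^n`
  -- cancels the uniform factors.
  have hI : Fintype.card Idea = 2 := rfl
  simp only [Finset.card_univ, Fintype.card_fun, Finset.prod_const, hI,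
    Fintype.card_equiv (Fintype.equivFin V).symm, Fintype.card_fin, nsmul_eq_mul]
  push_cast
  have : ((Fintype.card V).factorial : ℝ) ≠ 0 := by positivity
  rw [one_mul, ← mul_pow, ← mul_pow, ← mul_pow]
  convert one_pow (M := ℝ) (Fintype.card V) using 2
  field_simp

/-- The coins of a vertex are independent of everything that does not depend on them. -/
lemma sum_weight_mul_coin (N : Network V) (q : GAP) (ρ : Idea → ℝ) (v : V)
    (F : (Idea → Decision → Bool) → ℝ) {G : World V → ℝ}
    (hG : ∀ W c, G (World.setCoin W v c) = G W) :
    ∑ W : World V, W.weight N q ρ * (F (W.coin v) * G W) =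
      (∑ c, q.coinsProb ρ c * F c) * ∑ W : World V, W.weight N q ρ * G W := by
  rw [sum_weight_congr_of_setCoin N q ρ v (G := fun W => (∑ c, q.coinsProb ρ c * F c) * G W),
    Finset.mul_sum]
  · exact Finset.sum_congr rfl fun W _ => by ring
  · intro W
    simp only [hG, World.setCoin_coin, Function.update_self, ← Finset.sum_mul, sum_coinsProb,
      ← mul_assoc, one_mul]

/-- The coins of a vertex with outcomes `a`, `g`, `r` for the decisions on `A`. -/
def mkCoins (b : Decision → Bool) (a g r : Bool) : Idea → Decision → Bool
  | .A, .alone => a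
  | .A, .given => g
  | .A, .reconsider => r
  | .B, d => b d

lemma mkCoins_eta (c : Idea → Decision → Bool) :
    mkCoins (c .B) (c .A .alone) (c .A .given) (c .A .reconsider) = c := by
  funext i d
  cases i <;> cases d <;> rfl

/-- The coins of a vertex, decision by decision for `A`. -/
def coinsEquiv : (Decision → Bool) × Bool × Bool × Bool ≃ (Idea → Decision → Bool) where
  toFun x := mkCoins x.1 x.2.1 x.2.2.1 x.2.2.2
  invFun c := (c .B, c .A .alone, c .A .given, c .A .reconsider)
  left_inv _ := rfl
  right_inv c := mkCoins_eta c

lemma prod_idea {M : Type*} [CommMonoid M] (f : Idea → M) : ∏ i, f i = f .A * f .B := by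
  have : (Finset.univ : Finset Idea) = {.A, .B} := rfl
  simp [this]

lemma prod_decision {M : Type*} [CommMonoid M] (f : Decision → M) :
    ∏ d, f d = f .alone * f .given * f .reconsider := by
  have : (Finset.univ : Finset Decision) = {.alone, .given, .reconsider} := rfl
  simp [this, mul_assoc]

lemma sum_coins (F : (Idea → Decision → Bool) → ℝ) :
    ∑ c, F c = ∑ b, ∑ a, ∑ g, ∑ r, F (mkCoins b a g r) := by
  rw [← Equiv.sum_comp coinsEquiv]
  simp only [Fintype.sum_prod_type]
  rfl

lemma coinsProb_mkCoins (q : GAP) (ρ : Idea → ℝ) (b : Decision → Bool) (a g r : Bool) :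
    q.coinsProb ρ (mkCoins b a g r) = (∏ d, coinProb (q.prob ρ .B d) (b d)) *
      (coinProb (q.alone .A) a * coinProb (q.given .A) g * coinProb (ρ .A) r) := by
  rw [GAP.coinsProb, prod_idea, mul_comm, prod_decision (fun d => coinProb (q.prob ρ .A d) _)]
  rfl

end Probability

/-! ### Replacing `given A` by a function of the other coins -/

section Coupling

variable {V : Type*} [Fintype V] [DecidableEq V]

/-- Make the decision `given A` a function of the decisions `alone A` and `reconsider A`. -/
def coupleCoins (κ : Bool → Bool → Bool) (c : Idea → Decision → Bool) : Idea → Decision → Bool :=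
  mkCoins (c .B) (c .A .alone) (κ (c .A .alone) (c .A .reconsider)) (c .A .reconsider)

/-- Couple the decisions of all vertices in `T`. -/
def World.couple (κ : Bool → Bool → Bool) (T : Finset V) (W : World V) : World V :=
  { W with coin := fun v => if v ∈ T then coupleCoins κ (W.coin v) else W.coin v }

/-- The expectation does not change under the coupling if the given function, for each outcome,
ignores either the decision `given A` or the decisions `alone A` and `reconsider A`. -/
lemma sum_coinsProb_couple (q : GAP) (ρ : Idea → ℝ) (κ : Bool → Bool → Bool)
    (hκ : ∑ a, ∑ r, coinProb (q.alone .A) a * coinProb (ρ .A) r * (if κ a r then 1 else 0) =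
      q.given .A)
    (f : (Idea → Decision → Bool) → ℝ)
    (hf : ∀ b a g r a' g' r', f (mkCoins b a g' r) = f (mkCoins b a g r) ∨
      f (mkCoins b a' g r') = f (mkCoins b a g r)) :
    ∑ c, q.coinsProb ρ c * f c = ∑ c, q.coinsProb ρ c * f (coupleCoins κ c) := by
  rw [sum_coins, sum_coins]
  refine Finset.sum_congr rfl fun b _ => ?_
  have hcouple : ∀ a g r, coupleCoins κ (mkCoins b a g r) = mkCoins b a (κ a r) r :=
    fun _ _ _ => rfl
  simp only [coinsProb_mkCoins, hcouple]
  generalize (∏ d, coinProb (q.prob ρ .B d) (b d)) = p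
  -- Fix the outcomes for `B`. Either `f` never depends on `given A`, and the coupling is invisible,
  -- or it does so at some `(a₀, r₀)`. In the second case `hf` forces `f` to ignore `alone A` and
  -- `reconsider A` everywhere, and only the marginal of `given A` counts, which `hκ` preserves.
  by_cases h : ∀ a g g' r, f (mkCoins b a g r) = f (mkCoins b a g' r)
  · have h' : ∀ a g r, f (mkCoins b a g r) = f (mkCoins b a true r) := fun a g r => h a g true r
    simp only [h' _ (κ _ _) _]
    exact Finset.sum_congr rfl fun a _ => Finset.sum_congr rfl fun g _ =>
      Finset.sum_congr rfl fun r _ => by rw [h' a g r]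
  · push Not at h
    obtain ⟨a₀, g₀, g₁, r₀, h⟩ := h
    have hne : g₀ ≠ g₁ := fun e => h (by rw [e])
    have hind : ∀ a g r, f (mkCoins b a g r) = f (mkCoins b a₀ g r₀) := by
      intro a g r
      rcases (show g = g₀ ∨ g = g₁ by cases g <;> cases g₀ <;> cases g₁ <;> simp_all) with rfl | rfl
      · exact (hf b a₀ g r₀ a g₁ r).resolve_left (fun e => h e.symm)
      · exact (hf b a₀ g r₀ a g₀ r).resolve_left h
    simp only [hind _ _ _]
    generalize hF : (fun g => f (mkCoins b a₀ g r₀)) = F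
    have hF' : ∀ g, f (mkCoins b a₀ g r₀) = F g := fun g => by rw [← hF]
    simp only [hF']
    rw [← hκ]
    simp only [Fintype.sum_bool]
    cases κ true true <;> cases κ true false <;> cases κ false true <;> cases κ false false <;>
      simp [coinProb] <;> ring

lemma World.couple_setCoin_of_notMem (κ : Bool → Bool → Bool) {T : Finset V} {v : V} (hv : v ∉ T)
    (W : World V) (c : Idea → Decision → Bool) :
    (W.setCoin v c).couple κ T = (W.couple κ T).setCoin v c := by
  simp only [World.couple, World.setCoin, World.mk.injEq, true_and]
  funext u
  by_cases h : u = v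
  · subst h; simp [hv]
  · simp [Function.update_of_ne h]

lemma World.couple_insert_setCoin (κ : Bool → Bool → Bool) (T : Finset V) (v : V)
    (W : World V) (c : Idea → Decision → Bool) :
    (W.setCoin v c).couple κ (insert v T) = (W.couple κ T).setCoin v (coupleCoins κ c) := by
  simp only [World.couple, World.setCoin, World.mk.injEq, true_and]
  funext u
  by_cases h : u = v
  · subst h; simp
  · simp [h]

/-- Vertices are coupled one at a time, conditionally on everything except the coins of the current
vertex. The hypothesis `hf` covers all worlds because it is applied to partially coupled ones. -/
lemma sum_weight_couple (N : Network V) (q : GAP) (ρ : Idea → ℝ) (κ : Bool → Bool → Bool)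
    (hκ : ∑ a, ∑ r, coinProb (q.alone .A) a * coinProb (ρ .A) r * (if κ a r then 1 else 0) =
      q.given .A)
    (f : World V → ℝ)
    (hf : ∀ (W : World V) v b a g r a' g' r',
      f (W.setCoin v (mkCoins b a g' r)) = f (W.setCoin v (mkCoins b a g r)) ∨
      f (W.setCoin v (mkCoins b a' g r')) = f (W.setCoin v (mkCoins b a g r))) (T : Finset V) :
    ∑ W : World V, W.weight N q ρ * f W =
      ∑ W : World V, W.weight N q ρ * f (W.couple κ T) := by
  induction T using Finset.induction_on with
  | empty => simp [World.couple]
  | insert v T hv ih =>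
    rw [ih]
    refine sum_weight_congr_of_setCoin N q ρ v fun W => ?_
    simp only [World.couple_setCoin_of_notMem κ hv, World.couple_insert_setCoin]
    exact sum_coinsProb_couple q ρ κ hκ (fun c => f ((W.couple κ T).setCoin v c))
      (hf (W.couple κ T) v)

end Coupling

@[simp] lemma Idea.other_A : Idea.A.other = .B := rfl

@[simp] lemma Idea.other_B : Idea.B.other = .A := rfl

/-! ### No cascade consults both `given A` and `alone A` at one vertex -/

section Ignored

/-- `x₁` and `x₂` are the states which a vertex in state `x₀` would have, had its decision
`given A`, or its decisions `alone A` and `reconsider A`, been different. -/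
def Node.Ignores (x₀ x₁ x₂ : Node) : Prop :=
  (x₁ = x₀ ∧ x₂ = x₀ ∧ x₀.status .A = .idle) ∨ (x₁ = x₀ ∧ x₀.status .A ≠ .idle) ∨
    (x₂ = x₀ ∧ (x₀.status .A = .adopted ∨ x₀.status .A = .rejected))

lemma Node.receive_A (x : Node) (recon : Bool) (c : Idea → Decision → Bool) :
    x.receive recon c .A = if x.status .A = .idle then
      if x.status .B = .adopted then
        if c .A .given then x.adopt .A else x.mark .A .rejected
      else if c .A .alone then
        if x.status .B = .suspended then
          if c .B .reconsider then (x.adopt .A).adopt .B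
          else (x.adopt .A).mark .B .rejected
        else x.adopt .A
      else if recon then x.mark .A .suspended
      else x.mark .A .rejected
    else x := rfl

lemma Node.receive_B (x : Node) (recon : Bool) (c : Idea → Decision → Bool) :
    x.receive recon c .B = if x.status .B = .idle then
      if x.status .A = .adopted then
        if c .B .given then x.adopt .B else x.mark .B .rejected
      else if c .B .alone then
        if x.status .A = .suspended then
          if c .A .reconsider then (x.adopt .B).adopt .A
          else (x.adopt .B).mark .A .rejected
        else x.adopt .B
      else if recon then x.mark .B .suspended
      else x.mark .B .rejected
    else x := rfl

lemma Node.adopt_status (x : Node) (i j : Idea) :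
    (x.adopt i).status j = if j = i then .adopted else x.status j := by
  simp [Node.adopt, Function.update_apply]

lemma Node.mark_status (x : Node) (i j : Idea) (s : Status) :
    (x.mark i s).status j = if j = i then s else x.status j := by
  simp [Node.mark, Function.update_apply]

/-- `c₁` and `c₂` are obtained from `c₀` by changing the decision `given A` and the decisions
`alone A` and `reconsider A`, respectively. -/
structure CoinsVariants (c₀ c₁ c₂ : Idea → Decision → Bool) : Prop where
  alone₁ : c₁ .A .alone = c₀ .A .alone
  reconsider₁ : c₁ .A .reconsider = c₀ .A .reconsider
  given₂ : c₂ .A .given = c₀ .A .given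
  other₁ : c₁ .B = c₀ .B
  other₂ : c₂ .B = c₀ .B

section

variable {c₀ c₁ c₂ : Idea → Decision → Bool} (recon : Bool)

/-- Once `A` is not idle, further `A`-proposals have no effect and only reconsideration can change
its status, so `given A` is not consulted again. -/
lemma CoinsVariants.receive_of_ne_idle (hc : CoinsVariants c₀ c₁ c₂) {x : Node} (h : x.status .A ≠ .idle) (i : Idea) :
    x.receive recon c₁ i = x.receive recon c₀ i ∧ (x.receive recon c₀ i).status .A ≠ .idle := by
  cases i
  · simp [Node.receive_A, h]
  · simp only [Node.receive_B, hc.reconsider₁, hc.other₁, true_and]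
    split_ifs <;> simp_all [Node.adopt_status, Node.mark_status]

lemma CoinsVariants.foldl_receive_of_ne_idle (hc : CoinsVariants c₀ c₁ c₂) (l : List Idea) :
    ∀ {x : Node}, x.status .A ≠ .idle →
      l.foldl (Node.receive recon c₁) x = l.foldl (Node.receive recon c₀) x ∧
        (l.foldl (Node.receive recon c₀) x).status .A ≠ .idle := by
  induction l with
  | nil => exact fun h => ⟨rfl, h⟩
  | cons i l ih =>
    intro x h
    obtain ⟨h₁, h₂⟩ := hc.receive_of_ne_idle recon h i
    rw [List.foldl_cons, List.foldl_cons, h₁]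
    exact ih h₂

lemma CoinsVariants.receive_of_final (hc : CoinsVariants c₀ c₁ c₂) {x : Node}
    (h : x.status .A = .adopted ∨ x.status .A = .rejected) (i : Idea) :
    x.receive recon c₂ i = x.receive recon c₀ i ∧
      ((x.receive recon c₀ i).status .A = .adopted ∨
        (x.receive recon c₀ i).status .A = .rejected) := by
  cases i
  · rcases h with h | h <;> simp [Node.receive_A, h]
  · rcases h with h | h <;>
    · simp only [Node.receive_B, h, hc.other₂, reduceCtorEq, if_false, if_true, true_and]
      split_ifs <;> simp_all [Node.adopt_status, Node.mark_status]

lemma CoinsVariants.foldl_receive_of_final (hc : CoinsVariants c₀ c₁ c₂) (l : List Idea) :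
    ∀ {x : Node}, (x.status .A = .adopted ∨ x.status .A = .rejected) →
      l.foldl (Node.receive recon c₂) x = l.foldl (Node.receive recon c₀) x ∧
        ((l.foldl (Node.receive recon c₀) x).status .A = .adopted ∨
          (l.foldl (Node.receive recon c₀) x).status .A = .rejected) := by
  induction l with
  | nil => exact fun h => ⟨rfl, h⟩
  | cons i l ih =>
    intro x h
    obtain ⟨h₁, h₂⟩ := hc.receive_of_final recon h i
    rw [List.foldl_cons, List.foldl_cons, h₁]
    exact ih h₂

/-- The first `A`-proposal decides. If `B` is adopted, only `given A` is read and the status becomes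
final; otherwise only `alone A` is read, and `given A` is out of play from then on. -/
lemma CoinsVariants.foldl_receive_of_idle (hc : CoinsVariants c₀ c₁ c₂) (l : List Idea) :
    ∀ {x : Node}, x.status .A = .idle →
      (l.foldl (Node.receive recon c₀) x).Ignores
        (l.foldl (Node.receive recon c₁) x) (l.foldl (Node.receive recon c₂) x) := by
  induction l with
  | nil => exact fun h => Or.inl ⟨rfl, rfl, h⟩
  | cons i l ih =>
    intro x h
    simp only [List.foldl_cons]
    cases i
    · by_cases h' : x.status .B = .adopted
      · have e : x.receive recon c₂ .A = x.receive recon c₀ .A := by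
          simp only [Node.receive_A, h, h', if_true, hc.given₂]
        rw [e]
        refine Or.inr (Or.inr (hc.foldl_receive_of_final recon l ?_))
        simp only [Node.receive_A, h, h', if_true]
        split_ifs <;> simp [Node.adopt_status, Node.mark_status]
      · have e : x.receive recon c₁ .A = x.receive recon c₀ .A := by
          simp only [Node.receive_A, h, h', if_true, if_false, hc.alone₁, hc.other₁]
        rw [e]
        refine Or.inr (Or.inl (hc.foldl_receive_of_ne_idle recon l ?_))
        simp only [Node.receive_A, h, h', if_true, if_false]
        split_ifs <;> simp [Node.adopt_status, Node.mark_status]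
    · have e₁ : x.receive recon c₁ .B = x.receive recon c₀ .B := by
        simp only [Node.receive_B, h, hc.other₁, reduceCtorEq, if_false]
      have e₂ : x.receive recon c₂ .B = x.receive recon c₀ .B := by
        simp only [Node.receive_B, h, hc.other₂, reduceCtorEq, if_false]
      rw [e₁, e₂]
      refine ih ?_
      simp only [Node.receive_B, h, reduceCtorEq, if_false]
      split_ifs <;> simp [Node.adopt_status, Node.mark_status, h]

end

variable {V : Type*} [Fintype V] [DecidableEq V]

lemma World.step_setCoin (W : World V) (recon : Bool) (v : V) (c : Idea → Decision → Bool)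
    (x : V → Node) :
    (W.setCoin v c).step recon x = Function.update (W.step recon x) v
      ((W.inbox x v).foldl (Node.receive recon c) { status := (x v).status, fresh := [] }) := by
  funext u
  by_cases h : u = v
  · subst h
    simp only [World.step, World.setCoin_coin, Function.update_self]
    rfl
  · simp only [World.step, World.setCoin_coin, Function.update_of_ne h]
    rfl

/-- All three runs coincide while `A` is idle at `v`; afterwards one of the variants keeps following
the original. Agreement is stated for all earlier times too, so that one late time controls the
whole past. -/
lemma cascade_ignores {c₀ c₁ c₂ : Idea → Decision → Bool} (hc : CoinsVariants c₀ c₁ c₂)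
    (W : World V) (recon : Bool) (S : Idea → Finset V) (v : V)
    {x₀ x₁ x₂ : ℕ → V → Node} (h₀ : x₀ = (W.setCoin v c₀).cascade recon S)
    (h₁ : x₁ = (W.setCoin v c₁).cascade recon S) (h₂ : x₂ = (W.setCoin v c₂).cascade recon S)
    (t : ℕ) :
    ((∀ s ≤ t, x₁ s = x₀ s) ∧ (∀ s ≤ t, x₂ s = x₀ s) ∧ (x₀ t v).status .A = .idle) ∨
    ((∀ s ≤ t, x₁ s = x₀ s) ∧ (x₀ t v).status .A ≠ .idle) ∨
    ((∀ s ≤ t, x₂ s = x₀ s) ∧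
      ((x₀ t v).status .A = .adopted ∨ (x₀ t v).status .A = .rejected)) := by
  have succ : ∀ c t, (W.setCoin v c).cascade recon S (t + 1) =
      Function.update (W.step recon ((W.setCoin v c).cascade recon S t)) v
        ((W.inbox ((W.setCoin v c).cascade recon S t) v).foldl (Node.receive recon c)
          { status := ((W.setCoin v c).cascade recon S t v).status, fresh := [] }) :=
    fun c t => W.step_setCoin recon v c _
  have s₀ : ∀ t, x₀ (t + 1) = Function.update (W.step recon (x₀ t)) v
      ((W.inbox (x₀ t) v).foldl (Node.receive recon c₀) ⟨(x₀ t v).status, []⟩) := h₀ ▸ succ c₀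
  have s₁ : ∀ t, x₁ (t + 1) = Function.update (W.step recon (x₁ t)) v
      ((W.inbox (x₁ t) v).foldl (Node.receive recon c₁) ⟨(x₁ t v).status, []⟩) := h₁ ▸ succ c₁
  have s₂ : ∀ t, x₂ (t + 1) = Function.update (W.step recon (x₂ t)) v
      ((W.inbox (x₂ t) v).foldl (Node.receive recon c₂) ⟨(x₂ t v).status, []⟩) := h₂ ▸ succ c₂
  induction t with
  | zero =>
    have e₁ : x₁ 0 = x₀ 0 := by rw [h₀, h₁]; rfl
    have e₂ : x₂ 0 = x₀ 0 := by rw [h₀, h₂]; rfl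
    by_cases h : (x₀ 0 v).status .A = .idle
    · exact Or.inl ⟨by simp [e₁], by simp [e₂], h⟩
    · exact Or.inr (Or.inl ⟨by simp [e₁], h⟩)
  | succ t ih =>
    simp only [Nat.le_add_one_iff, or_imp, forall_and, forall_eq, s₀ t, s₁ t, s₂ t,
      Function.update_self]
    rcases ih with ⟨i₁, i₂, h⟩ | ⟨i₁, h⟩ | ⟨i₂, h⟩
    · rw [i₁ t le_rfl, i₂ t le_rfl]
      rcases hc.foldl_receive_of_idle recon (W.inbox (x₀ t) v) (x := ⟨(x₀ t v).status, []⟩) h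
        with ⟨e₁, e₂, h'⟩ | ⟨e₁, h'⟩ | ⟨e₂, h'⟩
      · exact Or.inl ⟨⟨i₁, by rw [e₁]⟩, ⟨i₂, by rw [e₂]⟩, h'⟩
      · exact Or.inr (Or.inl ⟨⟨i₁, by rw [e₁]⟩, h'⟩)
      · exact Or.inr (Or.inr ⟨⟨i₂, by rw [e₂]⟩, h'⟩)
    · obtain ⟨e₁, h'⟩ := hc.foldl_receive_of_ne_idle recon (W.inbox (x₀ t) v)
        (x := ⟨(x₀ t v).status, []⟩) h
      exact Or.inr (Or.inl ⟨⟨i₁, by rw [i₁ t le_rfl, e₁]⟩, h'⟩)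
    · obtain ⟨e₂, h'⟩ := hc.foldl_receive_of_final recon (W.inbox (x₀ t) v)
        (x := ⟨(x₀ t v).status, []⟩) h
      exact Or.inr (Or.inr ⟨⟨i₂, by rw [i₂ t le_rfl, e₂]⟩, h'⟩)

lemma cascade_eq_or_cascade_eq {c₀ c₁ c₂ : Idea → Decision → Bool}
    (hc : CoinsVariants c₀ c₁ c₂) (W : World V) (recon : Bool) (S : Idea → Finset V) (v : V) :
    (W.setCoin v c₁).cascade recon S = (W.setCoin v c₀).cascade recon S ∨
      (W.setCoin v c₂).cascade recon S = (W.setCoin v c₀).cascade recon S := by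
  by_contra! h
  obtain ⟨t₁, h₁⟩ := Function.ne_iff.1 h.1
  obtain ⟨t₂, h₂⟩ := Function.ne_iff.1 h.2
  -- The two variants may deviate at different times; the invariant at the later time contradicts
  -- one of the deviations.
  rcases cascade_ignores hc W recon S v rfl rfl rfl (max t₁ t₂) with
    ⟨i₁, -, -⟩ | ⟨i₁, -⟩ | ⟨i₂, -⟩
  · exact h₁ (i₁ t₁ (le_max_left _ _))
  · exact h₁ (i₁ t₁ (le_max_left _ _))
  · exact h₂ (i₂ t₂ (le_max_right _ _))

lemma influenceA_congr {W W' : World V} {recon : Bool} {SA SB : Finset V}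
    (h : W'.cascade recon (seeds SA SB) = W.cascade recon (seeds SA SB)) :
    W'.influenceA recon SA SB = W.influenceA recon SA SB := by
  unfold World.influenceA World.Adopts
  rw [h]

/-- In the computation of `σ_A` the decision `given A` may be coupled with the decisions
`alone A` and `reconsider A`. -/
lemma sigmaA_eq_couple (recon : Bool) (N : Network V) (q : GAP) (ρ : Idea → ℝ)
    (κ : Bool → Bool → Bool)
    (hκ : ∑ a, ∑ r, coinProb (q.alone .A) a * coinProb (ρ .A) r * (if κ a r then 1 else 0) =
      q.given .A) (SA SB : Finset V) :
    sigmaA recon N q ρ SA SB =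
      ∑ W : World V, W.weight N q ρ * ((W.couple κ Finset.univ).influenceA recon SA SB : ℝ) := by
  refine sum_weight_couple N q ρ κ hκ (fun W => (W.influenceA recon SA SB : ℝ)) ?_ Finset.univ
  intro W v b a g r a' g' r'
  have hc : CoinsVariants (mkCoins b a g r) (mkCoins b a g' r) (mkCoins b a' g r') :=
    ⟨rfl, rfl, rfl, rfl, rfl⟩
  rcases cascade_eq_or_cascade_eq hc W recon (seeds SA SB) v with h | h
  · exact Or.inl (by rw [influenceA_congr h])
  · exact Or.inr (by rw [influenceA_congr h])

end Ignored

/-! ### The case `q_{A|∅} = q_{A|B}` -/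

section Indifferent

/-- A vertex reacts to the first `A`-proposal in the same way whether or not it has adopted
`B`. -/
def Indifferent (recon : Bool) (c : Idea → Decision → Bool) : Prop :=
  c .A .given = c .A .alone ∧
    (recon = false ∨ c .A .reconsider = false ∨ c .A .alone = true ∨ c .B .alone = false)

/-- Suspension of `A` occurs only after refusing `A`. -/
def Node.Harmless (recon : Bool) (c : Idea → Decision → Bool) (x : Node) : Prop :=
  x.status .A = .suspended → recon = true ∧ c .A .alone = false

variable {recon : Bool} {c : Idea → Decision → Bool}

/-- Whether a refused `A` is suspended or rejected may depend on `B`, but neither status can lead to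
adoption. Hence idleness and adoption of `A` evolve under `A`-proposals alone. -/
lemma Indifferent.receive (hc : Indifferent recon c) {x : Node} (hx : x.Harmless recon c)
    (i : Idea) :
    (x.receive recon c i).Harmless recon c ∧
    ((x.receive recon c i).status .A = .idle ↔ x.status .A = .idle ∧ i ≠ .A) ∧
    ((x.receive recon c i).status .A = .adopted ↔ x.status .A = .adopted ∨
      x.status .A = .idle ∧ i = .A ∧ c .A .alone) ∧
    (.A ∈ (x.receive recon c i).fresh ↔ .A ∈ x.fresh ∨
      x.status .A = .idle ∧ i = .A ∧ c .A .alone) := by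
  obtain ⟨hg, hr⟩ := hc
  cases i
  · simp only [Node.receive_A, hg]
    split_ifs <;> simp_all [Node.Harmless, Node.adopt_status, Node.mark_status] <;>
      simp [Node.adopt, Node.mark]
  · simp only [Node.receive_B]
    split_ifs <;> simp_all [Node.Harmless, Node.adopt_status, Node.mark_status] <;>
      simp [Node.adopt, Node.mark]

lemma Indifferent.foldl_receive (hc : Indifferent recon c) (l : List Idea) :
    ∀ {x : Node}, x.Harmless recon c →
    (l.foldl (Node.receive recon c) x).Harmless recon c ∧
    ((l.foldl (Node.receive recon c) x).status .A = .idle ↔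
      x.status .A = .idle ∧ .A ∉ l) ∧
    ((l.foldl (Node.receive recon c) x).status .A = .adopted ↔ x.status .A = .adopted ∨
      x.status .A = .idle ∧ .A ∈ l ∧ c .A .alone) ∧
    (.A ∈ (l.foldl (Node.receive recon c) x).fresh ↔ .A ∈ x.fresh ∨
      x.status .A = .idle ∧ .A ∈ l ∧ c .A .alone) := by
  induction l with
  | nil => intro x hx; simpa using hx
  | cons i l ih =>
    intro x hx
    obtain ⟨h₁, h₂, h₃, h₄⟩ := hc.receive hx i
    obtain ⟨k₁, k₂, k₃, k₄⟩ := ih h₁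
    simp only [List.foldl_cons, k₂, k₃, k₄, h₂, h₃, h₄, List.mem_cons, not_or]
    refine ⟨k₁, ?_, ?_, ?_⟩
    all_goals
      clear ih k₁ k₂ k₃ k₄ h₁ h₂ h₃ h₄
      cases i <;> simp

variable {V : Type*} [Fintype V] [DecidableEq V]

lemma World.mem_inbox {V : Type*} [Fintype V] {W : World V} {x : V → Node} {v : V} {i : Idea} :
    i ∈ W.inbox x v ↔ ∃ u, W.live u v = true ∧ i ∈ (x u).fresh := by
  simp only [World.inbox, List.mem_flatMap, List.mem_ofFn]
  constructor
  · rintro ⟨u, -, h⟩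
    split_ifs at h with hl
    · exact ⟨u, hl, h⟩
    · simp at h
  · rintro ⟨u, hl, h⟩
    exact ⟨u, ⟨(W.order v).symm u, by simp⟩, by simpa [hl] using h⟩

lemma World.mem_init_fresh {W : World V} {S : Idea → Finset V} {v : V} {i : Idea} :
    i ∈ (W.init S v).fresh ↔ v ∈ S i := by
  simp only [World.init, List.mem_filter, decide_eq_true_eq, and_iff_right_iff_imp]
  intro _
  cases i <;> cases W.first v <;> simp

/-- If all vertices are indifferent, then the spread of `A` does not depend on the seeds of
`B`. -/
lemma cascade_of_indifferent (W : World V) (recon : Bool)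
    (hW : ∀ v, Indifferent recon (W.coin v)) {S S' : Idea → Finset V} (hS : S .A = S' .A)
    (t : ℕ) (v : V) :
    (W.cascade recon S t v).Harmless recon (W.coin v) ∧
    (W.cascade recon S' t v).Harmless recon (W.coin v) ∧
    ((W.cascade recon S t v).status .A = .idle ↔ (W.cascade recon S' t v).status .A = .idle) ∧
    ((W.cascade recon S t v).status .A = .adopted ↔
      (W.cascade recon S' t v).status .A = .adopted) ∧
    (.A ∈ (W.cascade recon S t v).fresh ↔ .A ∈ (W.cascade recon S' t v).fresh) := by
  induction t generalizing v with
  | zero =>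
    have h : ∀ S : Idea → Finset V, (W.init S v).Harmless recon (W.coin v) := by
      intro S hs
      simp only [World.init] at hs
      split_ifs at hs
    refine ⟨h S, h S', ?_⟩
    simp only [World.cascade, World.mem_init_fresh]
    simp [World.init, hS]
  | succ t ih =>
    obtain ⟨h₁, h₂, h₃, h₄, -⟩ := ih v
    have hin : .A ∈ W.inbox (W.cascade recon S t) v ↔ .A ∈ W.inbox (W.cascade recon S' t) v := by
      simp only [World.mem_inbox, (ih _).2.2.2.2]
    obtain ⟨k₁, k₂, k₃, k₄⟩ := (hW v).foldl_receive (W.inbox (W.cascade recon S t) v)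
      (x := ⟨(W.cascade recon S t v).status, []⟩) h₁
    obtain ⟨l₁, l₂, l₃, l₄⟩ := (hW v).foldl_receive (W.inbox (W.cascade recon S' t) v)
      (x := ⟨(W.cascade recon S' t v).status, []⟩) h₂
    simp only [World.cascade, World.step]
    refine ⟨k₁, l₁, ?_, ?_, ?_⟩
    · rw [k₂, l₂, h₃, hin]
    · rw [k₃, l₃, h₃, h₄, hin]
    · rw [k₄, l₄, h₃, hin]

lemma influenceA_of_indifferent (W : World V) (recon : Bool)
    (hW : ∀ v, Indifferent recon (W.coin v)) (SA SB SB' : Finset V) :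
    W.influenceA recon SA SB = W.influenceA recon SA SB' := by
  have h : ∀ v, W.Adopts recon (seeds SA SB) .A v ↔ W.Adopts recon (seeds SA SB') .A v :=
    fun v => exists_congr fun t =>
      (cascade_of_indifferent W recon hW (S := seeds SA SB) (S' := seeds SA SB') rfl t v).2.2.2.1
  classical exact congrArg Finset.card (Finset.filter_congr fun v _ => h v)

/-- A coin shows an outcome of probability `0` only in a world of weight `0`. -/
lemma coinProb_ne_zero_of_weight_ne_zero {V : Type*} [Fintype V] {W : World V} {N : Network V} {q : GAP}
    {ρ : Idea → ℝ} (h : W.weight N q ρ ≠ 0) (v : V) (i : Idea) (d : Decision) :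
    coinProb (q.prob ρ i d) (W.coin v i d) ≠ 0 := by
  have h₁ := Finset.prod_ne_zero_iff.1 (right_ne_zero_of_mul h) v (Finset.mem_univ v)
  have h₂ := Finset.prod_ne_zero_iff.1 (right_ne_zero_of_mul h₁) i (Finset.mem_univ i)
  exact Finset.prod_ne_zero_iff.1 h₂ d (Finset.mem_univ d)

lemma eq_false_of_coinProb_ne_zero {r : ℝ} {b : Bool} (h : coinProb r b ≠ 0) (hr : r = 0) :
    b = false := by
  cases b <;> simp_all [coinProb]

lemma eq_true_of_coinProb_ne_zero {r : ℝ} {b : Bool} (h : coinProb r b ≠ 0) (hr : r = 1) :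
    b = true := by
  cases b <;> simp_all [coinProb]

theorem sigmaA_eq_of_alone_eq_given (recon : Bool) (N : Network V) {q : GAP} {ρ : Idea → ℝ}
    (hρ : q.Admissible ρ) (h : q.alone .A = q.given .A) (SA SB SB' : Finset V) :
    sigmaA recon N q ρ SA SB = sigmaA recon N q ρ SA SB' := by
  have hκ : ∑ a, ∑ r, coinProb (q.alone .A) a * coinProb (ρ .A) r *
      (if (fun a _ : Bool => a) a r then 1 else 0) = q.given .A := by
    simp [coinProb, ← h]
    ring
  rw [sigmaA_eq_couple recon N q ρ _ hκ, sigmaA_eq_couple recon N q ρ _ hκ]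
  refine Finset.sum_congr rfl fun W _ => ?_
  by_cases hW : W.weight N q ρ = 0
  · simp [hW]
  rw [influenceA_of_indifferent (W.couple _ Finset.univ) recon ?_ SA SB SB']
  intro v
  have hc := coinProb_ne_zero_of_weight_ne_zero hW v
  have hA := (hρ .A).2.2
  rw [Idea.other_A, ← h] at hA
  -- Admissibility reduces to this vanishing product. Each factor that vanishes fixes a coin in
  -- every world of nonzero weight, giving one of the alternatives in `Indifferent`.
  have hprod : (1 - q.alone .A) * q.alone .B * ρ .A = 0 := by linarith
  simp only [World.couple, Finset.mem_univ, if_true, Indifferent, coupleCoins, mkCoins,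
    true_and]
  rcases mul_eq_zero.1 hprod with h' | h'
  · rcases mul_eq_zero.1 h' with h' | h'
    · exact Or.inr (Or.inr (Or.inl (eq_true_of_coinProb_ne_zero (hc .A .alone)
        (by simp only [GAP.prob]; linarith))))
    · exact Or.inr (Or.inr (Or.inr (eq_false_of_coinProb_ne_zero (hc .B .alone) h')))
  · exact Or.inr (Or.inl (eq_false_of_coinProb_ne_zero (hc .A .reconsider) h'))

end Indifferent

/-! ### Words of proposals and coverings of words -/

section Words

/-- The word `l'` contains no more ideas than `l`, and it starts with `A` if `l` does. -/
def Below (l' l : List Idea) : Prop :=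
  (∀ i ∈ l', i ∈ l) ∧ (l.head? = some .A → l'.head? = some .A)

/-- The words contain the same ideas, and both or none of them start with `A`. -/
def Similar (l l' : List Idea) : Prop :=
  (∀ i, i ∈ l ↔ i ∈ l') ∧ (l.head? = some .A ↔ l'.head? = some .A)

/-- Whatever happens to `B`, or to `A` after `B`, in the word `l` happens in some member of
the family `ls` of words below `l`. -/
structure Covers {ι : Type*} (l : List Idea) (ls : ι → List Idea) : Prop where
  below : ∀ s, Below (ls s) l
  exists_B : .B ∈ l → ∃ s, .B ∈ ls s
  exists_BA : .A ∈ l → l.head? ≠ some .A → ∃ s, .A ∈ ls s ∧ (ls s).head? ≠ some .A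

lemma Below.append {l₁' l₁ l₂' l₂ : List Idea} (h₁ : Below l₁' l₁) (h₂ : Below l₂' l₂) :
    Below (l₁' ++ l₂') (l₁ ++ l₂) := by
  refine ⟨fun i hi => ?_, ?_⟩
  · rw [List.mem_append] at hi ⊢
    exact hi.imp (h₁.1 i) (h₂.1 i)
  · cases l₁ with
    | nil =>
      have : l₁' = [] := List.eq_nil_iff_forall_not_mem.2 fun i hi => by simpa using h₁.1 i hi
      simpa [this] using h₂.2
    | cons j l₁ =>
      intro h
      have := h₁.2 (by simpa using h)
      simp [List.head?_append, this]

lemma eq_A_or_eq_B (i : Idea) : i = .A ∨ i = .B := by cases i <;> simp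

/-- An `A` after `B` in a concatenation arises within the first word, within the second, or from a
`B` in the first and an `A` heading the second. Only the last case mixes the words: a member
supplying the `B` also has the heading `A`, by `Below`. -/
lemma Covers.append {ι : Type*} {l₁ l₂ : List Idea} {ls₁ ls₂ : ι → List Idea}
    (h₁ : Covers l₁ ls₁) (h₂ : Covers l₂ ls₂) :
    Covers (l₁ ++ l₂) (fun s => ls₁ s ++ ls₂ s) := by
  refine ⟨fun s => (h₁.below s).append (h₂.below s), fun h => ?_, fun h hh => ?_⟩
  · rcases List.mem_append.1 h with h | h
    · obtain ⟨s, hs⟩ := h₁.exists_B h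
      exact ⟨s, List.mem_append_left _ hs⟩
    · obtain ⟨s, hs⟩ := h₂.exists_B h
      exact ⟨s, List.mem_append_right _ hs⟩
  · by_cases hA : .A ∈ l₁
    · have hl : l₁.head? ≠ some .A := by
        cases l₁ with
        | nil => simp
        | cons => simpa using hh
      obtain ⟨s, hs, hs'⟩ := h₁.exists_BA hA hl
      refine ⟨s, List.mem_append_left _ hs, ?_⟩
      cases hn : ls₁ s with
      | nil => simp [hn] at hs
      | cons => simpa [hn] using hs'
    · have h : .A ∈ l₂ := (List.mem_append.1 h).resolve_left hA
      have hAs : ∀ s, (ls₁ s).head? ≠ some .A := fun s e =>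
        hA ((h₁.below s).1 _ (List.mem_of_head? e))
      by_cases hl : l₂.head? = some .A
      · have hB : .B ∈ l₁ := by
          cases l₁ with
          | nil => exact absurd hl (by simpa using hh)
          | cons j l₁ =>
            rcases eq_A_or_eq_B j with rfl | rfl
            · simp at hA
            · simp
        obtain ⟨s, hs⟩ := h₁.exists_B hB
        refine ⟨s, List.mem_append_right _ (List.mem_of_head? ((h₂.below s).2 hl)), ?_⟩
        have := hAs s
        cases hn : ls₁ s with
        | nil => simp [hn] at hs
        | cons => simpa [hn] using this
      · obtain ⟨s, hs, hs'⟩ := h₂.exists_BA h hl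
        refine ⟨s, List.mem_append_right _ hs, ?_⟩
        have := hAs s
        cases hn : ls₁ s with
        | nil => simpa using hs'
        | cons => simpa [hn] using this

lemma Covers.flatMap {ι α : Type*} {f : α → List Idea} {fs : ι → α → List Idea}
    (h : ∀ u, Covers (f u) (fun s => fs s u)) (l : List α) :
    Covers (l.flatMap f) (fun s => l.flatMap (fs s)) := by
  induction l with
  | nil => exact ⟨fun s => ⟨by simp, by simp⟩, by simp, by simp⟩
  | cons u l ih => simpa only [List.flatMap_cons] using (h u).append ih

lemma Covers.congr {ι : Type*} {l l' : List Idea} {ls ls' : ι → List Idea}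
    (h : Covers l ls) (hl : Similar l' l) (hls : ∀ s, Similar (ls' s) (ls s)) :
    Covers l' ls' := by
  obtain ⟨h₁, h₂, h₃⟩ := h
  refine ⟨fun s => ⟨fun i => ?_, ?_⟩, ?_, ?_⟩
  · rw [(hls s).1, hl.1]; exact (h₁ s).1 i
  · rw [(hls s).2, hl.2]; exact (h₁ s).2
  · simpa only [(hls _).1, hl.1] using h₂
  · simpa only [(hls _).1, (hls _).2, hl.1, hl.2, ne_eq] using h₃

/-- The word `h` of adoptions of a vertex that accepts `B` always, receives the proposals `l`,
accepts `A` before `B` if `a` holds, and accepts `A` after `B` or reconsiders it successfully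
if `k` holds. -/
structure Reacts (recon a k : Bool) (l h : List Idea) : Prop where
  mem_B : .B ∈ h ↔ .B ∈ l
  head_A : h.head? = some .A ↔ l.head? = some .A ∧ a = true
  mem_A : .A ∈ h ↔ .A ∈ l ∧ (l.head? = some .A → a = true ∨ recon = true ∧ k = true ∧ .B ∈ l) ∧
    (l.head? ≠ some .A → k = true)

/-- A member may receive `A` before `B` where the full word has it after `B`; `hak` turns acceptance
there into acceptance here. -/
lemma Covers.reacts {ι : Type*} [Nonempty ι] {recon a k : Bool} (hak : a = true → k = true)
    {l h : List Idea} {ls hs : ι → List Idea}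
    (hl : Covers l ls) (hr : Reacts recon a k l h) (hrs : ∀ s, Reacts recon a k (ls s) (hs s)) :
    Covers h hs := by
  refine ⟨fun s => ⟨fun i hi => ?_, ?_⟩, ?_, ?_⟩
  · obtain ⟨b₁, b₂⟩ := hl.below s
    rcases eq_A_or_eq_B i with rfl | rfl
    · rw [(hrs s).mem_A] at hi
      rw [hr.mem_A]
      refine ⟨b₁ _ hi.1, fun e => ?_, fun e => ?_⟩
      · exact (hi.2.1 (b₂ e)).imp_right fun ⟨p, p', p''⟩ => ⟨p, p', b₁ _ p''⟩
      · by_cases e' : (ls s).head? = some .A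
        · exact (hi.2.1 e').elim hak fun p => p.2.1
        · exact hi.2.2 e'
    · rw [hr.mem_B]
      exact b₁ _ ((hrs s).mem_B.1 hi)
  · rw [hr.head_A, (hrs s).head_A]
    exact And.imp_left (hl.below s).2
  · simpa only [hr.mem_B, (hrs _).mem_B] using hl.exists_B
  · rw [hr.mem_A]
    simp only [(hrs _).mem_A, (hrs _).head_A, hr.head_A, ne_eq]
    rintro ⟨hA, h₁, h₂⟩ hn
    by_cases e : l.head? = some .A
    · have ha : ¬ a = true := fun ha => hn ⟨e, ha⟩
      obtain ⟨hr, hk, hB⟩ := (h₁ e).resolve_left ha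
      obtain ⟨s, hs⟩ := hl.exists_B hB
      have e' := (hl.below s).2 e
      exact ⟨s, ⟨List.mem_of_head? e', fun _ => Or.inr ⟨hr, hk, hs⟩, fun n => absurd e' n⟩,
        fun p => ha p.2⟩
    · obtain ⟨s, hs, hs'⟩ := hl.exists_BA hA e
      exact ⟨s, ⟨hs, fun n => absurd n hs', fun _ => h₂ e⟩, fun p => hs' p.1⟩

end Words

/-! ### Arrivals and adoptions when every `B`-proposal is accepted -/

section Tracks

/-- The statuses of a vertex that has received the proposals `l` and made the adoptions `h`. -/
structure Tracks (recon a k : Bool) (l : List Idea) (st : Idea → Status) (h : List Idea) :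
    Prop extends Reacts recon a k l h where
  status_B : st .B = if .B ∈ l then .adopted else .idle
  status_A : st .A = if .A ∈ l then
    if .A ∈ h then .adopted
    else if recon = true ∧ l.head? = some .A ∧ .B ∉ l then .suspended else .rejected
    else .idle

/-- A vertex that accepts every `B`-proposal, and that either is an `A`-seed or accepts `A`
after `B` exactly if it would accept `A` before `B` or reconsider it successfully. -/
def Eager (seed : Prop) (a k : Bool) (c : Idea → Decision → Bool) : Prop :=
  c .B .alone = true ∧ c .B .given = true ∧
    (seed ∧ a = true ∧ k = true ∨
      c .A .alone = a ∧ c .A .given = k ∧ k = (a || c .A .reconsider))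

lemma head?_append_singleton (l : List Idea) (i : Idea) :
    (l ++ [i]).head? = some .A ↔ l.head? = some .A ∨ .A ∉ l ∧ .B ∉ l ∧ i = .A := by
  cases l with
  | nil => simp
  | cons j l => cases j <;> simp

/-- The word `p` stores the adoptions of earlier steps, since `fresh` is emptied at each step. The
coins of a seed for `A` are unconstrained: `A` is already in `l`. -/
lemma Tracks.receive {recon a k : Bool} {c : Idea → Decision → Bool} {l : List Idea}
    (hc : Eager (.A ∈ l) a k c) {x : Node} {p : List Idea}
    (h : Tracks recon a k l x.status (p ++ x.fresh)) (i : Idea) :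
    Tracks recon a k (l ++ [i]) (x.receive recon c i).status
      (p ++ (x.receive recon c i).fresh) := by
  obtain ⟨h₁, h₂, hc⟩ := hc
  obtain ⟨⟨r₁, r₂, r₃⟩, s₁, s₂⟩ := h
  have hl : l.head? = some .A → .A ∈ l := List.mem_of_head?
  generalize hw : p ++ x.fresh = h at r₁ r₂ r₃ s₂
  have f₁ : ∀ i, p ++ (x.adopt i).fresh = h ++ [i] := fun i => by simp [Node.adopt, ← hw]
  have f₂ : ∀ i s, p ++ (x.mark i s).fresh = h := fun i s => by simp [Node.mark, ← hw]
  have f₃ : ∀ i j s, p ++ ((x.adopt i).mark j s).fresh = h ++ [i] :=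
    fun i j s => by simp [Node.adopt, Node.mark, ← hw]
  have f₄ : ∀ i j, p ++ ((x.adopt i).adopt j).fresh = (h ++ [i]) ++ [j] :=
    fun i j => by simp [Node.adopt, ← hw]
  cases i
  · by_cases hA : .A ∈ l
    · have e : x.receive recon c .A = x := by
        rw [Node.receive_A, if_neg]
        rw [s₂, if_pos hA]
        split_ifs <;> simp
      rw [e, hw]
      refine ⟨⟨?_, ?_, ?_⟩, ?_, ?_⟩ <;>
            simp only [List.mem_append, List.mem_singleton, head?_append_singleton, ne_eq] <;>
        simp [hA, r₁, r₂, r₃, s₁, s₂]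
    · obtain ⟨c₁, c₂, c₃⟩ := hc.resolve_left fun p => hA p.1
      rw [if_neg hA] at s₂
      have hA' : l.head? ≠ some .A := fun e => hA (hl e)
      have hh : .A ∉ h := fun e => hA (r₃.1 e).1
      by_cases hB : .B ∈ l
      · rw [if_pos hB] at s₁
        rw [Node.receive_A, if_pos s₂, if_pos s₁, c₂]
        have hB' := r₁.2 hB
        cases k <;>
        · simp only [if_true, if_false, Bool.false_eq_true, f₁, f₂]
          refine ⟨⟨?_, ?_, ?_⟩, ?_, ?_⟩ <;>
            simp only [List.mem_append, List.mem_singleton, head?_append_singleton, ne_eq] <;>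
            simp [hA, hA', hB, hB', hh, s₁, Node.adopt_status,
              Node.mark_status, r₂]
      · rw [if_neg hB] at s₁
        have hB' : .B ∉ h := fun e => hB (r₁.1 e)
        rw [Node.receive_A, if_pos s₂, s₁, c₁]
        cases a <;> cases recon <;>
        · simp only [reduceCtorEq, if_true, if_false, Bool.false_eq_true, f₁, f₂]
          refine ⟨⟨?_, ?_, ?_⟩, ?_, ?_⟩ <;>
            simp only [List.mem_append, List.mem_singleton, head?_append_singleton, ne_eq] <;>
            simp [hA, hA', hB, hB', hh, s₁, Node.adopt_status,
              Node.mark_status, r₂]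
  · by_cases hB : .B ∈ l
    · have e : x.receive recon c .B = x := by
        rw [Node.receive_B, if_neg]
        rw [s₁, if_pos hB]
        simp
      rw [e, hw]
      refine ⟨⟨?_, ?_, ?_⟩, ?_, ?_⟩ <;>
            simp only [List.mem_append, List.mem_singleton, head?_append_singleton, ne_eq] <;>
        simp [hB, r₁, r₂, r₃, s₁, s₂]
    · have hB' : .B ∉ h := fun e => hB (r₁.1 e)
      rw [if_neg hB] at s₁
      by_cases hA : .A ∈ l
      · have hh : l.head? = some .A := by
          cases l with
          | nil => simp at hA
          | cons j l => cases j <;> simp_all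
        rw [if_pos hA] at s₂
        simp only [hA, hh, hB, true_and, not_true_eq_false, and_false, or_false, ne_eq,
          false_imp_iff, and_true, forall_const, not_false_eq_true] at r₂ r₃ s₂
        rw [Node.receive_B, if_pos s₁, h₁, h₂]
        cases ha : a
        · have hn : .A ∉ h := fun e => by simpa [ha] using r₃.1 e
          have hk : k = c .A .reconsider := by
            simp only [ha, Bool.false_eq_true, false_and, and_false, false_or] at hc
            exact hc.2.2
          rw [if_neg hn] at s₂
          cases hr : recon
          · rw [hr, if_neg (by simp)] at s₂
            rw [s₂]
            simp only [reduceCtorEq, if_true, if_false, f₁]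
            refine ⟨⟨?_, ?_, ?_⟩, ?_, ?_⟩ <;>
              simp only [List.mem_append, List.mem_singleton, head?_append_singleton, ne_eq] <;>
              simp [hA, hh, hB, hB', hn, s₂, r₂, ha, Node.adopt_status]
          · rw [hr, if_pos rfl] at s₂
            rw [s₂, ← hk]
            cases k <;>
            · simp only [reduceCtorEq, if_true, if_false, Bool.false_eq_true, f₃, f₄]
              refine ⟨⟨?_, ?_, ?_⟩, ?_, ?_⟩ <;>
                simp only [List.mem_append, List.mem_singleton, head?_append_singleton, ne_eq] <;>
                simp [hA, hh, hB, hB', hn, r₂, ha, Node.adopt_status, Node.mark_status]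
        · have hn : .A ∈ h := r₃.2 ha
          rw [if_pos hn] at s₂
          rw [s₂]
          simp only [if_true, f₁]
          refine ⟨⟨?_, ?_, ?_⟩, ?_, ?_⟩ <;>
            simp only [List.mem_append, List.mem_singleton, head?_append_singleton, ne_eq] <;>
            simp [hA, hh, hB, hB', hn, s₂, r₂, ha, Node.adopt_status]
      · rw [if_neg hA] at s₂
        have hA' : l.head? ≠ some .A := fun e => hA (hl e)
        have hh : .A ∉ h := fun e => hA (r₃.1 e).1
        rw [Node.receive_B, if_pos s₁, s₂, h₁]
        simp only [reduceCtorEq, if_true, if_false, f₁]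
        refine ⟨⟨?_, ?_, ?_⟩, ?_, ?_⟩ <;>
            simp only [List.mem_append, List.mem_singleton, head?_append_singleton, ne_eq] <;>
            simp [hA, hA', hB, hB', hh, s₂, Node.adopt_status,
              r₂]

lemma Eager.mono {P Q : Prop} {a k : Bool} {c : Idea → Decision → Bool} (h : Eager P a k c)
    (hPQ : P → Q) : Eager Q a k c :=
  ⟨h.1, h.2.1, h.2.2.imp_left (And.imp_left hPQ)⟩

lemma Tracks.foldl_receive {recon a k : Bool} {c : Idea → Decision → Bool} {p : List Idea}
    (m : List Idea) : ∀ {l : List Idea}, Eager (.A ∈ l) a k c → ∀ {x : Node},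
      Tracks recon a k l x.status (p ++ x.fresh) →
      Tracks recon a k (l ++ m) (m.foldl (Node.receive recon c) x).status
        (p ++ (m.foldl (Node.receive recon c) x).fresh) := by
  induction m with
  | nil => intro l _ x h; simpa using h
  | cons i m ih =>
    intro l hc x h
    rw [List.append_cons, List.foldl_cons]
    exact ih (hc.mono (List.mem_append_left _)) (h.receive hc i)

variable {V : Type*} [Fintype V] [DecidableEq V]

/-- All proposals made to a vertex up to time `t`; seeds propose to themselves at time `0`. -/
def World.arrivals (W : World V) (recon : Bool) (S : Idea → Finset V) : ℕ → V → List Idea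
  | 0, v => (W.init S v).fresh
  | t + 1, v => W.arrivals recon S t v ++ W.inbox (W.cascade recon S t) v

/-- All adoptions of a vertex up to time `t`. -/
def World.history (W : World V) (recon : Bool) (S : Idea → Finset V) : ℕ → V → List Idea
  | 0, v => (W.init S v).fresh
  | t + 1, v => W.history recon S t v ++ (W.cascade recon S (t + 1) v).fresh

/-- All adoptions of the in-neighbours of a vertex up to time `t`. -/
def World.proposals (W : World V) (recon : Bool) (S : Idea → Finset V) (t : ℕ) (v : V) :
    List Idea :=
  (List.ofFn (W.order v)).flatMap fun u => if W.live u v then W.history recon S t u else []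

variable {W : World V} {recon : Bool} {S : Idea → Finset V} {a k : V → Bool}

lemma World.mem_arrivals_of_seed {i : Idea} {v : V} (h : v ∈ S i) (t : ℕ) :
    i ∈ W.arrivals recon S t v := by
  induction t with
  | zero => exact World.mem_init_fresh.2 h
  | succ t ih => exact List.mem_append_left _ ih

/-- Seeds are treated as receiving their own ideas at time 0; setting `a` and `k` to true at
`A`-seeds makes this obey the reaction law. -/
lemma tracks_cascade (hW : ∀ v, Eager (v ∈ S .A) (a v) (k v) (W.coin v))
    (ha : ∀ v ∈ S .A, a v = true ∧ k v = true) (t : ℕ) (v : V) :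
    Tracks recon (a v) (k v) (W.arrivals recon S t v) (W.cascade recon S t v).status
      (W.history recon S t v) := by
  induction t with
  | zero =>
    have hA : Idea.A ∈ (W.init S v).fresh ↔ v ∈ S .A := World.mem_init_fresh
    have hB : Idea.B ∈ (W.init S v).fresh ↔ v ∈ S .B := World.mem_init_fresh
    refine ⟨⟨Iff.rfl, ?_, ?_⟩, ?_, ?_⟩
    · exact (and_iff_left_of_imp fun h => (ha v (hA.1 (List.mem_of_head? h))).1).symm
    · exact (and_iff_left_of_imp fun h => ⟨fun _ => Or.inl (ha v (hA.1 h)).1,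
        fun _ => (ha v (hA.1 h)).2⟩).symm
    · simp only [World.arrivals, hB]
      rfl
    · simp only [World.arrivals, World.history, hA]
      by_cases h : v ∈ S .A <;> simp [World.cascade, World.init, h]
  | succ t ih =>
    have := Tracks.foldl_receive (W.inbox (W.cascade recon S t) v)
      ((hW v).mono fun h => World.mem_arrivals_of_seed h t)
      (x := ⟨(W.cascade recon S t v).status, []⟩) (by simpa using ih)
    exact this

lemma World.fresh_subset_history {i : Idea} {t : ℕ} {u : V}
    (h : i ∈ (W.cascade recon S t u).fresh) : i ∈ W.history recon S t u := by
  cases t with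
  | zero => exact h
  | succ t => exact List.mem_append_right _ h

lemma World.mem_arrivals_of_mem_history {i : Idea} {u v : V} (hl : W.live u v = true) (t : ℕ)
    (h : i ∈ W.history recon S t u) : i ∈ W.arrivals recon S (t + 1) v := by
  induction t with
  | zero => exact List.mem_append_right _ (World.mem_inbox.2 ⟨u, hl, h⟩)
  | succ t ih =>
    rcases List.mem_append.1 h with h | h
    · exact List.mem_append_left _ (ih h)
    · exact List.mem_append_right _ (World.mem_inbox.2 ⟨u, hl, h⟩)

lemma World.mem_proposals {i : Idea} {t : ℕ} {v : V} :
    i ∈ W.proposals recon S t v ↔ ∃ u, W.live u v = true ∧ i ∈ W.history recon S t u :=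
  World.mem_inbox (W := W) (x := fun u => ⟨fun _ => .idle, W.history recon S t u⟩)

/-- It makes no difference if vertices repeat all their proposals in every step. -/
lemma similar_arrivals (t : ℕ) (v : V) :
    Similar (W.arrivals recon S (t + 1) v)
      (W.arrivals recon S t v ++ W.proposals recon S t v) := by
  refine ⟨fun i => ⟨fun h => ?_, fun h => ?_⟩, ?_⟩
  · rcases List.mem_append.1 h with h | h
    · exact List.mem_append_left _ h
    · obtain ⟨u, hl, h⟩ := World.mem_inbox.1 h
      exact List.mem_append_right _
        (World.mem_proposals.2 ⟨u, hl, World.fresh_subset_history h⟩)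
  · rcases List.mem_append.1 h with h | h
    · exact List.mem_append_left _ h
    · obtain ⟨u, hl, h⟩ := World.mem_proposals.1 h
      exact World.mem_arrivals_of_mem_history hl t h
  · rw [World.arrivals]
    -- A nonempty word has its head fixed already. If nothing has arrived, no live in-neighbour
    -- adopted before time `t`, so histories and fresh adoptions coincide.
    cases hn : W.arrivals recon S t v with
    | cons => simp
    | nil =>
      have : W.inbox (W.cascade recon S t) v = W.proposals recon S t v := by
        unfold World.inbox World.proposals
        congr 1
        funext u
        split_ifs with hl
        · cases t with
          | zero => rfl
          | succ t =>
            have : W.history recon S t u = [] := List.eq_nil_iff_forall_not_mem.2 fun i hi => by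
              have := World.mem_arrivals_of_mem_history hl t hi
              simp [hn] at this
            simp [World.history, this]
        · rfl
      rw [this]

end Tracks

/-! ### The case `q_{B|∅} = 1` -/

section Coverage

variable {V : Type*} [Fintype V] [DecidableEq V] {W : World V} {recon : Bool} {SA : Finset V}
  {a k : V → Bool}

/-- The induction uses full histories, because a smaller seed set may make the same adoption later
and the words of fresh adoptions need not be covered. Proposals are concatenated in the same order
for all seed sets, so coverings of the in-neighbours' histories combine. -/
lemma covers_cascade (hW : ∀ v, Eager (v ∈ SA) (a v) (k v) (W.coin v))
    (ha : ∀ v ∈ SA, a v = true ∧ k v = true) (hak : ∀ v, a v = true → k v = true)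
    {ι : Type*} [Nonempty ι] {SB : Finset V} {TB : ι → Finset V}
    (hT : ∀ v, v ∈ SB ↔ ∃ s, v ∈ TB s) (t : ℕ) (v : V) :
    Covers (W.arrivals recon (seeds SA SB) t v) (fun s => W.arrivals recon (seeds SA (TB s)) t v) ∧
    Covers (W.history recon (seeds SA SB) t v)
      (fun s => W.history recon (seeds SA (TB s)) t v) := by
  have react : ∀ t, (∀ v, Covers (W.arrivals recon (seeds SA SB) t v)
      (fun s => W.arrivals recon (seeds SA (TB s)) t v)) → ∀ v,
      Covers (W.history recon (seeds SA SB) t v)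
      (fun s => W.history recon (seeds SA (TB s)) t v) := fun t h v =>
    (h v).reacts (hak v) (tracks_cascade (S := seeds SA SB) hW ha t v).toReacts
      (fun s => (tracks_cascade (S := seeds SA (TB s)) hW ha t v).toReacts)
  suffices h : ∀ v, Covers (W.arrivals recon (seeds SA SB) t v)
      (fun s => W.arrivals recon (seeds SA (TB s)) t v) from ⟨h v, react t h v⟩
  induction t with
  | zero =>
    intro v
    have hsub : ∀ s, v ∈ TB s → v ∈ SB := fun s h => (hT v).2 ⟨s, h⟩
    simp only [World.arrivals]
    refine ⟨fun s => ⟨fun i hi => ?_, ?_⟩, ?_, ?_⟩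
    · rw [World.mem_init_fresh] at hi ⊢
      cases i
      · exact hi
      · exact hsub s hi
    · have := hsub s
      by_cases h₁ : v ∈ SA <;> by_cases h₂ : v ∈ TB s <;> by_cases h₃ : v ∈ SB <;>
        cases h : W.first v <;> simp_all [World.init, seeds]
    · simp only [World.mem_init_fresh]
      exact (hT v).1
    · simp only [World.mem_init_fresh]
      intro hA hh
      -- An `A`-seed whose word does not start with `A` is also a `B`-seed; any member in which it
      -- is a `B`-seed gives it the identical word.
      have hB : v ∈ SB := by
        by_contra hB
        have : v ∈ SA := hA
        cases h : W.first v <;> simp [World.init, seeds, this, hB, h] at hh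
      obtain ⟨s, hs⟩ := (hT v).1 hB
      refine ⟨s, hA, ?_⟩
      have e : (W.init (seeds SA (TB s)) v).fresh = (W.init (seeds SA SB) v).fresh := by
        show List.filter _ _ = List.filter _ _
        refine List.filter_congr fun i _ => ?_
        cases i
        · rfl
        · exact decide_eq_decide.2 ⟨fun _ => hB, fun _ => hs⟩
      rwa [e]
  | succ t ih =>
    intro v
    refine ((ih v).append (l₂ := W.proposals recon (seeds SA SB) t v)
      (ls₂ := fun s => W.proposals recon (seeds SA (TB s)) t v) ?_).congr
      (similar_arrivals t v) (fun s => similar_arrivals t v)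
    refine Covers.flatMap (fun u => ?_) _
    split_ifs
    · exact react t ih u
    · exact ⟨fun s => ⟨by simp, by simp⟩, by simp, by simp⟩

/-- If the history starts with `A`, so does that of every member, and one exists; otherwise `A`
occurs after `B` and some member shows this. -/
lemma adopts_iff_exists (hW : ∀ v, Eager (v ∈ SA) (a v) (k v) (W.coin v))
    (ha : ∀ v ∈ SA, a v = true ∧ k v = true) (hak : ∀ v, a v = true → k v = true)
    {ι : Type*} [Nonempty ι] {SB : Finset V} {TB : ι → Finset V}
    (hT : ∀ v, v ∈ SB ↔ ∃ s, v ∈ TB s) (v : V) :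
    W.Adopts recon (seeds SA SB) .A v ↔ ∃ s, W.Adopts recon (seeds SA (TB s)) .A v := by
  have key : ∀ SB t, (W.cascade recon (seeds SA SB) t v).status .A = .adopted ↔
      .A ∈ W.history recon (seeds SA SB) t v := by
    intro SB t
    obtain ⟨⟨-, -, h₁⟩, -, h₂⟩ := tracks_cascade (recon := recon) (S := seeds SA SB) hW ha t v
    rw [h₂]
    refine ⟨fun h => ?_, fun h => by rw [if_pos (h₁.1 h).1, if_pos h]⟩
    split_ifs at h with p q r
    exact q
  simp only [World.Adopts, key]
  rw [exists_comm]
  refine exists_congr fun t => ?_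
  obtain ⟨h₁, -, h₃⟩ := (covers_cascade (recon := recon) hW ha hak hT t v).2
  constructor
  · intro h
    by_cases hh : (W.history recon (seeds SA SB) t v).head? = some .A
    · obtain ⟨s⟩ := ‹Nonempty ι›
      exact ⟨s, List.mem_of_head? ((h₁ s).2 hh)⟩
    · exact (h₃ h hh).imp fun s => And.left
  · rintro ⟨s, h⟩
    exact (h₁ s).1 _ h

lemma influenceA_submodular (hW : ∀ v, Eager (v ∈ SA) (a v) (k v) (W.coin v))
    (ha : ∀ v ∈ SA, a v = true ∧ k v = true) (hak : ∀ v, a v = true → k v = true)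
    (S : Finset V) (x y : V) :
    W.influenceA recon SA S + W.influenceA recon SA (S ∪ {x, y}) ≤
      W.influenceA recon SA (S ∪ {x}) + W.influenceA recon SA (S ∪ {y}) := by
  classical
  have union := adopts_iff_exists (recon := recon) hW ha hak (SB := S ∪ {x, y})
    (TB := fun b : Bool => if b then S ∪ {x} else S ∪ {y}) (by simp; tauto)
  -- Monotonicity is the union property for the family consisting of `S` and `S ∪ {z}`.
  have mono : ∀ z v, W.Adopts recon (seeds SA S) .A v → W.Adopts recon (seeds SA (S ∪ {z})) .A v :=
    fun z v h => (adopts_iff_exists (recon := recon) hW ha hak (SB := S ∪ {z})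
      (TB := fun b : Bool => if b then S else S ∪ {z}) (by simp) v).2 ⟨true, h⟩
  simp only [Bool.exists_bool, if_true, Bool.false_eq_true, if_false] at union
  unfold World.influenceA
  rw [add_comm, ← Finset.card_union_add_card_inter
    (Finset.univ.filter fun v => W.Adopts recon (seeds SA (S ∪ {x})) .A v)]
  refine Nat.add_le_add (Finset.card_le_card fun v hv => ?_) (Finset.card_le_card fun v hv => ?_)
  · simp only [Finset.mem_union, Finset.mem_filter_univ] at hv ⊢
    exact ((union v).1 hv).symm
  · simp only [Finset.mem_inter, Finset.mem_filter_univ] at hv ⊢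
    exact ⟨mono x v hv, mono y v hv⟩

lemma weight_nonneg {V : Type*} [Fintype V] (W : World V) (N : Network V) {q : GAP} {ρ : Idea → ℝ}
    (hq : q.Complementary) (hρ : q.Admissible ρ) : 0 ≤ W.weight N q ρ := by
  have coin : ∀ {r : ℝ} {b : Bool}, 0 ≤ r → r ≤ 1 → 0 ≤ coinProb r b := by
    intro r b h₀ h₁
    cases b <;> simp [coinProb, h₀, h₁]
  refine mul_nonneg (Finset.prod_nonneg fun u _ => Finset.prod_nonneg fun v _ =>
    coin (N.p_nonneg u v) (N.p_le_one u v)) (Finset.prod_nonneg fun v _ => mul_nonneg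
      (by positivity) (Finset.prod_nonneg fun i _ => Finset.prod_nonneg fun d _ => ?_))
  obtain ⟨h₁, h₂, h₃⟩ := hq i
  cases d
  · exact coin h₁ (h₂.trans h₃)
  · exact coin (h₁.trans h₂) h₃
  · exact coin (hρ i).1 (hρ i).2.1

/-- Admissibility now says that `alone || reconsider` succeeds with probability `q_{A|B}`. Without
reconsideration the coin `reconsider A` is unused by the cascade and serves only as auxiliary
randomness for the coupling. -/
theorem submodular_sigmaA_of_alone_B_eq_one (recon : Bool) (N : Network V) {q : GAP}
    {ρ : Idea → ℝ} (hq : q.Complementary) (hρ : q.Admissible ρ) (h : q.alone .B = 1)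
    (SA : Finset V) : Submodular (fun SB => sigmaA recon N q ρ SA SB) := by
  intro S x y
  have hA := (hρ .A).2.2
  rw [Idea.other_A, h] at hA
  have hκ : ∑ a, ∑ r, coinProb (q.alone .A) a * coinProb (ρ .A) r *
      (if (a || r) then 1 else 0) = q.given .A := by
    simp [coinProb]
    linarith
  simp only [sigmaA_eq_couple recon N q ρ (fun a r => a || r) hκ]
  rw [← Finset.sum_add_distrib, ← Finset.sum_add_distrib]
  refine Finset.sum_le_sum fun W _ => ?_
  by_cases hW : W.weight N q ρ = 0
  · simp [hW]
  rw [← mul_add, ← mul_add]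
  refine mul_le_mul_of_nonneg_left ?_ (weight_nonneg W N hq hρ)
  have hB : q.given .B = 1 := le_antisymm (hq .B).2.2 (h ▸ (hq .B).2.1)
  have hc := coinProb_ne_zero_of_weight_ne_zero hW
  -- At `A`-seeds `a` and `k` are set to true regardless of the coins, which are never consulted
  -- about `A` there.
  refine mod_cast influenceA_submodular
    (a := fun v => W.coin v .A .alone || decide (v ∈ SA))
    (k := fun v => W.coin v .A .alone || decide (v ∈ SA) || W.coin v .A .reconsider)
    (fun v => ?_) (fun v hv => by simp [hv]) (fun v hv => by simp_all) S x y
  have h₁ := eq_true_of_coinProb_ne_zero (hc v .B .alone) h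
  have h₂ := eq_true_of_coinProb_ne_zero (hc v .B .given) hB
  refine ⟨?_, ?_, ?_⟩
  · simpa [World.couple, coupleCoins, mkCoins] using h₁
  · simpa [World.couple, coupleCoins, mkCoins] using h₂
  · by_cases hv : v ∈ SA
    · exact Or.inl (by simp [hv])
    · exact Or.inr (by simp [hv, World.couple, coupleCoins, mkCoins])

end Coverage

/-! ### The violating instance on the path -/

section Path

lemma flatMap_ite_eq {α β : Type*} [DecidableEq α] (a : α) (f : List β) {l : List α}
    (hl : l.Nodup) (ha : a ∈ l) : (l.flatMap fun u => if u = a then f else []) = f := by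
  induction l with
  | nil => simp at ha
  | cons b l ih =>
    rw [List.flatMap_cons]
    obtain ⟨hb, hl⟩ := List.nodup_cons.1 hl
    by_cases h : b = a
    · subst h
      rw [if_pos rfl, List.flatMap_eq_nil_iff.2, List.append_nil]
      intro u hu
      rw [if_neg]
      rintro rfl
      exact hb hu
    · rw [if_neg h, List.nil_append]
      exact ih hl ((List.mem_cons.1 ha).resolve_left fun e => h e.symm)

/-- Exactly the edges of the path `0 → 1 → 2 → 3` are live. -/
def World.IsPath (W : World (Fin 4)) : Prop :=
  ∀ u v, W.live u v = true ↔ u.val + 1 = v.val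

variable {W : World (Fin 4)} {recon : Bool}

lemma World.IsPath.inbox_zero (hW : W.IsPath) (x : Fin 4 → Node) : W.inbox x 0 = [] := by
  simp [World.inbox, hW _ _]

lemma World.IsPath.inbox (hW : W.IsPath) (x : Fin 4 → Node) {u v : Fin 4}
    (h : u.val + 1 = v.val) : W.inbox x v = (x u).fresh := by
  unfold World.inbox
  rw [← flatMap_ite_eq u (x u).fresh (List.nodup_ofFn.2 (W.order v).injective)
    (List.mem_ofFn.2 ⟨(W.order v).symm u, by simp⟩)]
  congr 1
  funext w
  by_cases hw : w = u
  · subst hw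
    rw [if_pos ((hW w v).2 h), if_pos rfl]
  · rw [if_neg hw, if_neg]
    rw [hW w v]
    exact fun e => hw (Fin.ext (by omega))

lemma Node.receive_status_adopted {x : Node} {j : Idea} (h : x.status j = .adopted)
    (c : Idea → Decision → Bool) (i : Idea) : (x.receive recon c i).status j = .adopted := by
  cases i <;> cases j
  · simp [Node.receive_A, h]
  · simp only [Node.receive_A, h, if_true, reduceCtorEq]
    split_ifs <;> simp [Node.adopt_status, Node.mark_status, h]
  · simp only [Node.receive_B, h, if_true, reduceCtorEq]
    split_ifs <;> simp [Node.adopt_status, Node.mark_status, h]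
  · simp [Node.receive_B, h]

lemma Node.foldl_receive_status_adopted (c : Idea → Decision → Bool) (j : Idea) (l : List Idea) :
    ∀ {x : Node}, x.status j = .adopted →
      (l.foldl (Node.receive recon c) x).status j = .adopted := by
  induction l with
  | nil => exact fun h => h
  | cons i l ih => exact fun h => ih (Node.receive_status_adopted h c i)

/-- The configuration of a path after `t` steps, as a function of the previous one. -/
lemma World.IsPath.cascade_succ (hW : W.IsPath) (S : Idea → Finset (Fin 4)) (t : ℕ)
    {u v : Fin 4} (h : u.val + 1 = v.val) :
    W.cascade recon S (t + 1) v = (W.cascade recon S t u).fresh.foldl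
      (Node.receive recon (W.coin v)) ⟨(W.cascade recon S t v).status, []⟩ := by
  rw [World.cascade, World.step, hW.inbox _ h]

lemma World.IsPath.cascade_succ_zero (hW : W.IsPath) (S : Idea → Finset (Fin 4)) (t : ℕ) :
    W.cascade recon S (t + 1) 0 = ⟨(W.cascade recon S t 0).status, []⟩ := by
  rw [World.cascade, World.step, hW.inbox_zero]
  rfl

/-- Vertex `1` accepts `A`. -/
def accepts₁ (W : World (Fin 4)) (SB : Finset (Fin 4)) : Bool :=
  if 1 ∈ SB then W.coin 1 .A .given else W.coin 1 .A .alone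

/-- Vertex `3` would accept `A`. -/
def accepts₃ (W : World (Fin 4)) (SB : Finset (Fin 4)) : Bool :=
  if 3 ∈ SB ∨ W.coin 3 .B .alone = true then W.coin 3 .A .given else W.coin 3 .A .alone

lemma World.init_status (S : Idea → Finset (Fin 4)) (v : Fin 4) (i : Idea) :
    (W.init S v).status i = if v ∈ S i then .adopted else .idle := rfl

lemma World.init_fresh_seeds (SA SB : Finset (Fin 4)) (v : Fin 4) (h : v ∉ SA ∨ v ∉ SB) :
    (W.init (seeds SA SB) v).fresh =
      if v ∈ SA then [.A] else if v ∈ SB then [.B] else [] := by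
  rcases h with h | h <;> cases hf : W.first v <;> simp [World.init, hf, seeds, h, List.filter_cons] <;>
    exact if_congr decide_eq_true_iff rfl rfl

variable {SB : Finset (Fin 4)}

/-- The `A`-wave can reach vertex `n` only at time `n`; each vertex is evaluated at that time, and
its `A`-status does not change afterwards. -/
lemma path_zero_fresh (hW : W.IsPath) (h0 : 0 ∉ SB) (t : ℕ) :
    (W.cascade recon (seeds {0} SB) t 0).fresh = if t = 0 then [.A] else [] := by
  cases t with
  | zero => rw [World.cascade, W.init_fresh_seeds {0} SB 0 (Or.inr h0)]; simp
  | succ t => rw [hW.cascade_succ_zero]; simp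

lemma path_one (hW : W.IsPath) (h0 : 0 ∉ SB) (t : ℕ) :
    ((W.cascade recon (seeds {0} SB) (t + 1) 1).status .A = .adopted ↔ accepts₁ W SB = true) ∧
    (W.cascade recon (seeds {0} SB) (t + 1) 1).fresh =
      if t = 0 ∧ accepts₁ W SB = true then [.A] else [] := by
  rw [hW.cascade_succ (u := 0) _ _ rfl, path_zero_fresh hW h0]
  induction t with
  | zero =>
    simp only [if_true, List.foldl_cons, List.foldl_nil, Node.receive_A, World.cascade,
      World.init_status, seeds, accepts₁]
    by_cases h1 : 1 ∈ SB <;> cases W.coin 1 .A .given <;> cases W.coin 1 .A .alone <;>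
      cases recon <;> simp [h1, Node.adopt, Node.mark]
  | succ t ih =>
    rw [hW.cascade_succ (u := 0) _ _ rfl, path_zero_fresh hW h0]
    simpa using ih.1

lemma path_two_one (hW : W.IsPath) (h2 : 2 ∈ SB) :
    W.cascade recon (seeds {0} SB) 1 2 = ⟨(W.init (seeds {0} SB) 2).status, []⟩ := by
  rw [hW.cascade_succ (u := 1) _ _ rfl, World.cascade, W.init_fresh_seeds _ _ _ (by simp)]
  by_cases h1 : 1 ∈ SB <;> simp [h1, Node.receive_B, World.init_status, seeds, h2]

lemma path_two (hW : W.IsPath) (h0 : 0 ∉ SB) (h2 : 2 ∈ SB) (t : ℕ) :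
    ((W.cascade recon (seeds {0} SB) (t + 2) 2).status .A = .adopted ↔
      accepts₁ W SB = true ∧ W.coin 2 .A .given = true) ∧
    (W.cascade recon (seeds {0} SB) (t + 2) 2).fresh =
      if t = 0 ∧ accepts₁ W SB = true ∧ W.coin 2 .A .given = true then [.A] else [] := by
  rw [hW.cascade_succ (u := 1) _ _ rfl, (path_one hW h0 _).2]
  induction t with
  | zero =>
    rw [path_two_one hW h2]
    cases accepts₁ W SB <;> cases hg : W.coin 2 .A .given <;>
      simp [Node.receive_A, World.init_status, seeds, h2, hg, Node.adopt, Node.mark]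
  | succ t ih =>
    rw [hW.cascade_succ (u := 1) _ _ rfl, (path_one hW h0 _).2]
    simpa using ih.1

/-- The `B`-proposal of vertex 2 arrives at time 1, before `A` can arrive at time 3. Nothing arrives
at time 2, because vertex 2 is a `B`-seed and ignores a `B`-proposal of vertex 1. -/
lemma path_three_two (hW : W.IsPath) (h2 : 2 ∈ SB) :
    (W.cascade recon (seeds {0} SB) 2 3).status .A = .idle ∧
    ((W.cascade recon (seeds {0} SB) 2 3).status .B = .adopted ↔
      3 ∈ SB ∨ W.coin 3 .B .alone = true) := by
  rw [hW.cascade_succ (u := 2) _ _ rfl, path_two_one hW h2, hW.cascade_succ (u := 2) _ _ rfl,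
    World.cascade, W.init_fresh_seeds _ _ _ (by simp)]
  by_cases h3 : 3 ∈ SB
  · simp [h2, h3, Node.receive_B, World.init_status, seeds]
  · cases hb : W.coin 3 .B .alone <;> cases recon <;>
      simp [h2, h3, hb, Node.receive_B, World.init_status, seeds, Node.adopt_status,
        Node.mark_status]

lemma path_three (hW : W.IsPath) (h0 : 0 ∉ SB) (h2 : 2 ∈ SB) (t : ℕ) :
    (W.cascade recon (seeds {0} SB) (t + 3) 3).status .A = .adopted ↔
      accepts₁ W SB = true ∧ W.coin 2 .A .given = true ∧ accepts₃ W SB = true := by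
  rw [hW.cascade_succ (u := 2) _ _ rfl, (path_two hW h0 h2 _).2]
  induction t with
  | zero =>
    obtain ⟨hA, hB⟩ := path_three_two (recon := recon) hW h2
    cases accepts₁ W SB
    · simp [hA]
    cases W.coin 2 .A .given
    · simp [hA]
    simp only [and_self, if_true, List.foldl_cons, List.foldl_nil, Node.receive_A, zero_add, hA,
      hB, accepts₃, true_and]
    split_ifs <;> simp_all [Node.adopt_status, Node.mark_status]
  | succ t ih =>
    rw [hW.cascade_succ (u := 2) _ _ rfl, (path_two hW h0 h2 _).2]
    simpa using ih

lemma adopts_iff_three (W : World (Fin 4)) (recon : Bool) (S : Idea → Finset (Fin 4)) (i : Idea)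
    (v : Fin 4) : W.Adopts recon S i v ↔ ∃ t, (W.cascade recon S (t + 3) v).status i = .adopted := by
  refine ⟨fun ⟨t, ht⟩ => ⟨t, ?_⟩, fun ⟨t, ht⟩ => ⟨_, ht⟩⟩
  have : ∀ s, (W.cascade recon S (t + s) v).status i = .adopted := by
    intro s
    induction s with
    | zero => exact ht
    | succ s ih => exact Node.foldl_receive_status_adopted _ _ _ ih
  exact this 3

lemma influenceA_path (hW : W.IsPath) (h0 : 0 ∉ SB) (h2 : 2 ∈ SB) :
    W.influenceA recon {0} SB = 1 + (if accepts₁ W SB = true then 1 else 0) +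
      (if accepts₁ W SB = true ∧ W.coin 2 .A .given = true then 1 else 0) +
      (if accepts₁ W SB = true ∧ W.coin 2 .A .given = true ∧ accepts₃ W SB = true
        then 1 else 0) := by
  have a₀ : W.Adopts recon (seeds {0} SB) .A 0 := ⟨0, by
    rw [World.cascade, World.init_status]
    simp [seeds]⟩
  have a₁ : W.Adopts recon (seeds {0} SB) .A 1 ↔ accepts₁ W SB = true := by
    simp only [adopts_iff_three, (path_one hW h0 _).1, exists_const]
  have a₂ : W.Adopts recon (seeds {0} SB) .A 2 ↔
      accepts₁ W SB = true ∧ W.coin 2 .A .given = true := by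
    simp only [adopts_iff_three]
    exact (exists_congr fun t => (path_two hW h0 h2 (t + 1)).1).trans (by simp)
  have a₃ : W.Adopts recon (seeds {0} SB) .A 3 ↔
      accepts₁ W SB = true ∧ W.coin 2 .A .given = true ∧ accepts₃ W SB = true := by
    simp only [adopts_iff_three, path_three hW h0 h2, exists_const]
  classical
  unfold World.influenceA
  rw [Finset.card_filter, Fin.sum_univ_four]
  simp only [a₀, a₁, a₂, a₃, if_true]

/-- The indicator of a coin. -/
def ind (b : Bool) : ℝ := if b then 1 else 0

/-- The violation of submodularity in a given world. -/
lemma influenceA_path_diff (hW : W.IsPath) :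
    (W.influenceA recon {0} {2} : ℝ) + W.influenceA recon {0} ({2} ∪ {3, 1}) -
      (W.influenceA recon {0} ({2} ∪ {3}) + W.influenceA recon {0} ({2} ∪ {1})) =
    (ind (W.coin 1 .A .given) - ind (W.coin 1 .A .alone)) * (ind (W.coin 2 .A .given) *
      ((1 - ind (W.coin 3 .B .alone)) *
        (ind (W.coin 3 .A .given) - ind (W.coin 3 .A .alone)))) := by
  rw [influenceA_path hW (by decide) (by decide), influenceA_path hW (by decide) (by decide),
    influenceA_path hW (by decide) (by decide), influenceA_path hW (by decide) (by decide)]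
  have h₁ : accepts₁ W {2} = W.coin 1 .A .alone := if_neg (by decide)
  have h₂ : accepts₁ W ({2} ∪ {3, 1}) = W.coin 1 .A .given := if_pos (by decide)
  have h₃ : accepts₁ W ({2} ∪ {3}) = W.coin 1 .A .alone := if_neg (by decide)
  have h₄ : accepts₁ W ({2} ∪ {1}) = W.coin 1 .A .given := if_pos (by decide)
  have h₅ : accepts₃ W ({2} ∪ {3, 1}) = W.coin 3 .A .given := if_pos (Or.inl (by decide))
  have h₆ : accepts₃ W ({2} ∪ {3}) = W.coin 3 .A .given := if_pos (Or.inl (by decide))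
  have h₇ : ∀ T : Finset (Fin 4), 3 ∉ T →
      accepts₃ W T = bif W.coin 3 .B .alone then W.coin 3 .A .given else W.coin 3 .A .alone := by
    intro T hT
    cases hb : W.coin 3 .B .alone <;> simp [accepts₃, hb, hT]
  rw [h₁, h₂, h₃, h₄, h₅, h₆, h₇ {2} (by decide), h₇ ({2} ∪ {1}) (by decide)]
  simp only [ind]
  cases W.coin 1 .A .given <;> cases W.coin 1 .A .alone <;> cases W.coin 2 .A .given <;>
    cases W.coin 3 .B .alone <;> cases W.coin 3 .A .given <;> cases W.coin 3 .A .alone <;>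
    norm_num

lemma sum_coinsProb_given (q : GAP) (ρ : Idea → ℝ) :
    ∑ c, q.coinsProb ρ c * ind (c .A .given) = q.given .A := by
  simp only [sum_coins, coinsProb_mkCoins, mul_assoc, ← Finset.mul_sum, mkCoins]
  rw [← Finset.sum_mul, sum_prod_coinProb]
  simp [coinProb, ind]
  ring

lemma sum_coinsProb_given_sub_alone (q : GAP) (ρ : Idea → ℝ) :
    ∑ c, q.coinsProb ρ c * (ind (c .A .given) - ind (c .A .alone)) =
      q.given .A - q.alone .A := by
  simp only [sum_coins, coinsProb_mkCoins, mul_assoc, ← Finset.mul_sum, mkCoins]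
  rw [← Finset.sum_mul, sum_prod_coinProb]
  simp [coinProb, ind]
  ring

lemma sum_coinsProb_not_alone_B (q : GAP) (ρ : Idea → ℝ) :
    ∑ c, q.coinsProb ρ c * ((1 - ind (c .B .alone)) *
      (ind (c .A .given) - ind (c .A .alone))) =
      (1 - q.alone .B) * (q.given .A - q.alone .A) := by
  have hB : ∑ b : Decision → Bool, (∏ d, coinProb (q.prob ρ .B d) (b d)) * (1 - ind (b .alone)) =
      1 - q.alone .B := by
    -- The observable is written as a product over decisions with trivial factors, so that the
    -- expectation factorizes.
    have := Finset.prod_univ_sum (fun _ : Decision => (Finset.univ : Finset Bool))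
      (fun d b => coinProb (q.prob ρ .B d) b * if d = .alone then 1 - ind b else 1)
    rw [Fintype.piFinset_univ] at this
    simp only [Finset.prod_mul_distrib] at this
    simp only [prod_decision (fun d => if d = .alone then _ else _), reduceCtorEq, if_true,
      if_false, mul_one] at this
    rw [← this, prod_decision]
    simp [coinProb, ind, GAP.prob]
  rw [← hB, Finset.sum_mul, sum_coins]
  refine Finset.sum_congr rfl fun b _ => ?_
  simp only [coinsProb_mkCoins, mkCoins, Fintype.sum_bool]
  simp [coinProb, ind]
  ring

lemma isPath_of_weight_ne_zero {q : GAP} {ρ : Idea → ℝ} (h : W.weight pathNetwork q ρ ≠ 0) :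
    W.IsPath := by
  intro u v
  have := Finset.prod_ne_zero_iff.1 (Finset.prod_ne_zero_iff.1 (left_ne_zero_of_mul h) u
    (Finset.mem_univ u)) v (Finset.mem_univ v)
  by_cases huv : u.val + 1 = v.val
  · simp [eq_true_of_coinProb_ne_zero this (by simp [pathNetwork, huv]), huv]
  · simp [eq_false_of_coinProb_ne_zero this (by simp [pathNetwork, huv]), huv]

/-- The discrepancy in each world is a product of functions of the coins of three different
vertices, which are independent. -/
theorem sigmaA_path_diff (recon : Bool) (q : GAP) (ρ : Idea → ℝ) :
    sigmaA recon pathNetwork q ρ {0} {2} + sigmaA recon pathNetwork q ρ {0} ({2} ∪ {3, 1}) -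
      (sigmaA recon pathNetwork q ρ {0} ({2} ∪ {3}) +
        sigmaA recon pathNetwork q ρ {0} ({2} ∪ {1})) =
    (q.given .A - q.alone .A) * (q.given .A *
      ((1 - q.alone .B) * (q.given .A - q.alone .A))) := by
  have h : sigmaA recon pathNetwork q ρ {0} {2} +
      sigmaA recon pathNetwork q ρ {0} ({2} ∪ {3, 1}) -
      (sigmaA recon pathNetwork q ρ {0} ({2} ∪ {3}) +
        sigmaA recon pathNetwork q ρ {0} ({2} ∪ {1})) =
      ∑ W : World (Fin 4), W.weight pathNetwork q ρ *
        ((ind (W.coin 1 .A .given) - ind (W.coin 1 .A .alone)) * (ind (W.coin 2 .A .given) *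
          (((1 - ind (W.coin 3 .B .alone)) *
            -- The final factor 1 lets the last vertex be split off by the same lemma; what remains
            -- is the total weight.
            (ind (W.coin 3 .A .given) - ind (W.coin 3 .A .alone))) * 1))) := by
    simp only [sigmaA, ← Finset.sum_add_distrib, ← Finset.sum_sub_distrib]
    refine Finset.sum_congr rfl fun W _ => ?_
    by_cases hW : W.weight pathNetwork q ρ = 0
    · simp [hW]
    rw [mul_one, ← influenceA_path_diff (recon := recon) (isPath_of_weight_ne_zero hW)]
    ring
  rw [h, sum_weight_mul_coin pathNetwork q ρ 1 (fun c => ind (c .A .given) - ind (c .A .alone)),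
    sum_weight_mul_coin pathNetwork q ρ 2 (fun c => ind (c .A .given)),
    sum_weight_mul_coin pathNetwork q ρ 3 (fun c => (1 - ind (c .B .alone)) *
      (ind (c .A .given) - ind (c .A .alone))) (G := fun _ => 1) fun _ _ => rfl,
    sum_coinsProb_given_sub_alone, sum_coinsProb_given, sum_coinsProb_not_alone_B]
  · simp only [mul_one, sum_weight]
  · intro W c
    simp
  · intro W c
    simp

theorem path_violates_submodularity (recon : Bool) {q : GAP} (ρ : Idea → ℝ)
    (hq : q.Complementary) (h : ¬ (q.alone .A = q.given .A ∨ q.alone .B = 1)) :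
    sigmaA recon pathNetwork q ρ {0} {2} + sigmaA recon pathNetwork q ρ {0} ({2} ∪ {3, 1}) >
      sigmaA recon pathNetwork q ρ {0} ({2} ∪ {3}) +
        sigmaA recon pathNetwork q ρ {0} ({2} ∪ {1}) := by
  obtain ⟨hA, hB⟩ := not_or.1 h
  obtain ⟨a₁, a₂, -⟩ := hq .A
  obtain ⟨-, b₂, b₃⟩ := hq .B
  have hA' : 0 < q.given .A - q.alone .A := sub_pos.2 (lt_of_le_of_ne a₂ hA)
  have hB' : 0 < 1 - q.alone .B := sub_pos.2 (lt_of_le_of_ne (b₂.trans b₃) hB)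
  have hg : 0 < q.given .A := by linarith
  rw [gt_iff_lt, ← sub_pos, sigmaA_path_diff]
  positivity

end Path

end ComIC

end

theorem theorem4 :
    -- sufficiency, on every network and for every fixed `S_A`
    (∀ (recon : Bool) (q : ComIC.GAP) (ρ : ComIC.Idea → ℝ),
      q.Complementary → q.Admissible ρ →
      (q.alone .A = q.given .A ∨ q.alone .B = 1) →
      ∀ (V : Type*) [Fintype V] [DecidableEq V] (N : ComIC.Network V) (SA : Finset V),
        ComIC.Submodular (fun SB => ComIC.sigmaA recon N q ρ SA SB)) ∧
    -- one violating instance for all other parameters: the path `0 → 1 → 2 → 3` with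
    -- `S_A = {0}`, `S_B = {2}`, and additional `B`-seeds `3` and `1`
    (∀ (recon : Bool) (q : ComIC.GAP) (ρ : ComIC.Idea → ℝ),
      q.Complementary → q.Admissible ρ →
      ¬ (q.alone .A = q.given .A ∨ q.alone .B = 1) →
      ComIC.sigmaA recon ComIC.pathNetwork q ρ {0} {2} +
          ComIC.sigmaA recon ComIC.pathNetwork q ρ {0} ({2} ∪ {3, 1}) >
        ComIC.sigmaA recon ComIC.pathNetwork q ρ {0} ({2} ∪ {3}) +
          ComIC.sigmaA recon ComIC.pathNetwork q ρ {0} ({2} ∪ {1})) ∧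
    -- `q_{B|A} = 1` is not a sufficient condition
    (∀ recon : Bool, ∃ (q : ComIC.GAP) (ρ : ComIC.Idea → ℝ),
      q.Complementary ∧ q.Admissible ρ ∧ q.given .B = 1 ∧
      ¬ ComIC.Submodular (fun SB => ComIC.sigmaA recon ComIC.pathNetwork q ρ {0} SB)) := by
  refine ⟨?_, ?_, ?_⟩
  · intro recon q ρ hq hρ h V _ _ N SA
    rcases h with h | h
    · intro S a b
      exact le_of_eq (congrArg₂ (· + ·)
        (ComIC.sigmaA_eq_of_alone_eq_given recon N hρ h SA _ _)
        (ComIC.sigmaA_eq_of_alone_eq_given recon N hρ h SA _ _))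
    · exact ComIC.submodular_sigmaA_of_alone_B_eq_one recon N hq hρ h SA
  · exact fun recon q ρ hq _ h => ComIC.path_violates_submodularity recon ρ hq h
  · intro recon
    -- With these parameters and `ρ = 1`, both sides of the admissibility equation equal 3/4.
    have hq : (ComIC.GAP.mk (fun _ => 1 / 2) fun _ => 1).Complementary :=
      fun i => by norm_num
    refine ⟨⟨fun _ => 1 / 2, fun _ => 1⟩, fun _ => 1, hq, fun i => by norm_num, rfl,
      fun h => ?_⟩
    exact absurd (h {2} 3 1)
      (not_le.2 (ComIC.path_violates_submodularity recon (fun _ => 1) hq (by norm_num)))
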